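/- **Setting.** Let $A\in\mathbb R^{n\times n}$, $B\in\mathbb R^{n\times m}$, a sampling period $h>0$ and an integer delay $d\ge 1$ be given, and put $A_h=e^{Ah}$, $B_h=\int_0^h e^{A\tau}B\,d\tau$. Assume - H1) $A$ is unstable (it has an eigenvalue with nonnegative real part) and its eigenvalues are real and distinct; - H2) $B$ has full column rank; - H3) $(A,B)$ is controllable. For a dropout rate $p\in[0,1]$ let $(\gamma_k)_{k\ge 0}$ be i.i.d. with $\mathcal P(\gamma_k=0)=p$ and $\mathcal P(\gamma_k=1)=1-p$, where $\gamma_k$ says whether the control signal $u_{k-d}$, due at the actuator at time $k$, has arrived. The sampled system is $$x_{k+1}=A_hx_k+\gamma_k B_hu_{k-d},\qquad k\ge 0,$$ with deterministic initial values $x_0,u_{-d},\dots,u_{-1}$. A gain $K\in\mathbb R^{m\times n}$ is applied through the predictor feedback $u_{k-d}=K\,E[x_k\mid \gamma_0,\dots,\gamma_{k-d-1}]$ for $k\ge d$ (the conditional expectation is taken for the actual $p$), and it *stabilizes the system for the rate $p$* if $\lim_{k\to\infty}E\|x_k\|^2=0$ for all initial values. The system is stabilizable for the rate $p$ if some $K$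 stabilizes it. Let $p_{\max}$ be the largest number in $[0,1]$ such that the system is stabilizable for every rate $p<p_{\max}$. Let $0\le\hat p<p_{\max}$. Call the uncertain system, whose rate $p$ is only known to lie in $[0,\hat p]$, *stabilizable by $K$* if the same gain $K$ stabilizes the system for every $p\in[0,\hat p]$, and *stabilizable* if this holds for some $K$. For symmetric $X$ let $$\mathcal L_K(p,X)=X-[A_h+(1-p)B_hK]'X[A_h+(1-p)B_hK]-p(1-p)K'B_h'(A_h')^dXA_h^dB_hK,$$ and, for $\xi\ge 0$, let $\mathcal H_K(\xi,X)=\mathcal L_K\!\left(\tfrac{\hat p}{\xi+1},X\right)$. A matrix-valued function of $\xi\in\mathbb R$ is *SOS* if it equals $\sum_{i=1}^r M_i(\xi)'M_i(\xi)$ for finitely many real $n\times n$ matrix polynomials $M_i$ (so it is in particular a matrix polynomial). The degree $\deg P$ of a matrix polynomial is the maximum of the degrees of its entries. **Theorem.** The uncertain system is stabilizable if and only if there exist a gain $K$, an $n\times n$ matrix polynomial $P(\xi)$, a real $\theta>0$ and an integer $\zeta\ge\deg P$ such that $$P(\xi^2)-(\xi^2+1)^{\zeta}\,\theta I\quad\text{and}\quad(\xi^2+1)\,\mathcal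 H_K(\xi^2,P(\xi^2))-(\xi^2+1)^{\zeta+1}\,\theta I$$ are both SOS. More precisely, for every fixed gain $K$, the uncertain system is stabilizable by $K$ if and only if such $P,\theta,\zeta$ exist for this $K$. -/

import Mathlib

open MeasureTheory ProbabilityTheory Filter Topology Matrix
open scoped Polynomial

noncomputable section

/-! ### The sampled plant -/

/-- `A_h = exp (h A)`. -/
def sampledA {n : ℕ} (A : Matrix (Fin n) (Fin n) ℝ) (h : ℝ) : Matrix (Fin n) (Fin n) ℝ :=
  NormedSpace.exp (h • A)

/-- `B_h = ∫₀ʰ exp (τ A) B dτ`, computed entry by entry. -/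
def sampledB {n m : ℕ} (A : Matrix (Fin n) (Fin n) ℝ) (B : Matrix (Fin n) (Fin m) ℝ) (h : ℝ) :
    Matrix (Fin n) (Fin m) ℝ :=
  Matrix.of fun i j => ∫ τ in (0 : ℝ)..h, (NormedSpace.exp (τ • A) * B) i j

/-- `A` has `n` pairwise distinct real eigenvalues. -/
def HasDistinctRealEigenvalues {n : ℕ} (A : Matrix (Fin n) (Fin n) ℝ) : Prop :=
  ∃ lam : Fin n → ℝ, Function.Injective lam ∧
    ∀ i, Module.End.HasEigenvalue (Matrix.toLin' A) (lam i)

/-- A continuous-time system matrix with real spectrum is unstable if it has an eigenvalue `≥ 0`. -/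
def IsUnstable {n : ℕ} (A : Matrix (Fin n) (Fin n) ℝ) : Prop :=
  ∃ l : ℝ, 0 ≤ l ∧ Module.End.HasEigenvalue (Matrix.toLin' A) l

/-- Controllability of the pair `(A, B)`: the columns of `B, A B, …, A ^ (n - 1) B` span the
state space. -/
def IsControllable {n m : ℕ} (A : Matrix (Fin n) (Fin n) ℝ) (B : Matrix (Fin n) (Fin m) ℝ) : Prop :=
  Submodule.span ℝ {v : Fin n → ℝ | ∃ k < n, ∃ j : Fin m, v = (A ^ k * B).col j} = ⊤

/-! ### Packet dropout and the closed loop -/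

/-- `γ` is an i.i.d. sequence of binary variables with dropout rate `p`:
`γ k = 0` (dropout) with probability `p`, and `γ k = 1` (success) with probability `1 - p`.
Here `γ k` is the fate of the control signal `u_{k-d}` that is due at the actuator at time `k`. -/
structure IsDropoutProcess {Ω : Type*} [MeasurableSpace Ω] (p : ℝ) (μ : Measure Ω)
    (γ : ℕ → Ω → ℝ) : Prop where
  measurable : ∀ k, Measurable (γ k)
  indep : iIndepFun γ μ
  prob_zero : ∀ k, μ {ω | γ k ω = 0} = ENNReal.ofReal p
  prob_one : ∀ k, μ {ω | γ k ω = 1} = ENNReal.ofReal (1 - p)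

/-- The σ-algebra generated by `γ 0, …, γ (k - 1)`, the variables that enter `x 0, …, x k`. -/
@[reducible] def history {Ω : Type*} (γ : ℕ → Ω → ℝ) (k : ℕ) : MeasurableSpace Ω :=
  ⨆ j : ℕ, ⨆ _ : j < k, MeasurableSpace.comap (γ j) (inferInstance : MeasurableSpace ℝ)

/-- The state of the closed loop
`x (k+1) = A_h x k + γ k B_h u_{k-d}`, with `u_{k-d} = K E[x k | history up to time k - d]` for
`k ≥ d`, and with initial data `x 0 = x₀` and `u_{k-d} = φ k` for `k < d`. -/
def closedLoop {Ω : Type*} [MeasurableSpace Ω] (μ : Measure Ω) (γ : ℕ → Ω → ℝ) {n m : ℕ}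
    (Ah : Matrix (Fin n) (Fin n) ℝ) (Bh : Matrix (Fin n) (Fin m) ℝ) (d : ℕ)
    (K : Matrix (Fin m) (Fin n) ℝ) (x₀ : Fin n → ℝ) (φ : Fin d → Fin m → ℝ) :
    ℕ → Ω → (Fin n → ℝ)
  | 0 => fun _ => x₀
  | k + 1 => fun ω =>
      Ah *ᵥ closedLoop μ γ Ah Bh d K x₀ φ k ω +
        γ k ω • (Bh *ᵥ
          (if hk : k < d then φ ⟨k, hk⟩
            else K *ᵥ (μ[closedLoop μ γ Ah Bh d K x₀ φ k | history γ (k - d)]) ω))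

/-- The gain `K` makes the closed loop asymptotically mean square stable: `E ‖x k‖² → 0`
(Euclidean norm) for all initial values. -/
def IsStabilizedBy {Ω : Type*} [MeasurableSpace Ω] (μ : Measure Ω) (γ : ℕ → Ω → ℝ) {n m : ℕ}
    (Ah : Matrix (Fin n) (Fin n) ℝ) (Bh : Matrix (Fin n) (Fin m) ℝ) (d : ℕ)
    (K : Matrix (Fin m) (Fin n) ℝ) : Prop :=
  ∀ (x₀ : Fin n → ℝ) (φ : Fin d → Fin m → ℝ),
    Tendsto (fun k => ∫ ω, ∑ i, (closedLoop μ γ Ah Bh d K x₀ φ k ω i) ^ 2 ∂μ) atTop (𝓝 0)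

/-- Mean square stabilizability for one fixed dropout process. -/
def IsStabilizable {Ω : Type*} [MeasurableSpace Ω] (μ : Measure Ω) (γ : ℕ → Ω → ℝ) {n m : ℕ}
    (Ah : Matrix (Fin n) (Fin n) ℝ) (Bh : Matrix (Fin n) (Fin m) ℝ) (d : ℕ) : Prop :=
  ∃ K : Matrix (Fin m) (Fin n) ℝ, IsStabilizedBy μ γ Ah Bh d K

/-- The maximum packet dropout rate: the largest `q ∈ [0, 1]` such that the system is
stabilizable for every dropout rate `p < q`. The process with dropout rate `p` is `γ p` on the
probability space `(Ω p, μ p)`. -/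
def maxDropoutRate {Ω : unitInterval → Type*} [∀ p, MeasurableSpace (Ω p)]
    (μ : ∀ p, Measure (Ω p)) (γ : ∀ p, ℕ → Ω p → ℝ) {n m : ℕ}
    (Ah : Matrix (Fin n) (Fin n) ℝ) (Bh : Matrix (Fin n) (Fin m) ℝ) (d : ℕ) : ℝ :=
  sSup {q : ℝ | 0 ≤ q ∧ q ≤ 1 ∧
    ∀ p : unitInterval, (p : ℝ) < q → IsStabilizable (μ p) (γ p) Ah Bh d}

/-- The gain `K`, one and the same for all `p`, stabilizes the uncertain system, that is, it
stabilizes the system for every dropout rate `p ∈ [0, phat]`. -/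
def IsRobustlyStabilizedBy {Ω : unitInterval → Type*} [∀ p, MeasurableSpace (Ω p)]
    (μ : ∀ p, Measure (Ω p)) (γ : ∀ p, ℕ → Ω p → ℝ) {n m : ℕ}
    (Ah : Matrix (Fin n) (Fin n) ℝ) (Bh : Matrix (Fin n) (Fin m) ℝ) (d : ℕ) (phat : ℝ)
    (K : Matrix (Fin m) (Fin n) ℝ) : Prop :=
  ∀ p : unitInterval, (p : ℝ) ≤ phat → IsStabilizedBy (μ p) (γ p) Ah Bh d K

/-! ### Lyapunov operator and sums of squares -/

/-- The parameter-dependent Lyapunov operator `L_K(p, X)`. -/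
def lyapunovL {n m : ℕ} (Ah : Matrix (Fin n) (Fin n) ℝ) (Bh : Matrix (Fin n) (Fin m) ℝ) (d : ℕ)
    (K : Matrix (Fin m) (Fin n) ℝ) (p : ℝ) (X : Matrix (Fin n) (Fin n) ℝ) :
    Matrix (Fin n) (Fin n) ℝ :=
  X - (Ah + (1 - p) • (Bh * K))ᵀ * X * (Ah + (1 - p) • (Bh * K))
    - (p * (1 - p)) • (Kᵀ * Bhᵀ * (Ahᵀ) ^ d * X * Ah ^ d * Bh * K)

/-- `H_K(ξ, X) = L_K(phat / (ξ + 1), X)`. -/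
def lyapunovH {n m : ℕ} (Ah : Matrix (Fin n) (Fin n) ℝ) (Bh : Matrix (Fin n) (Fin m) ℝ) (d : ℕ)
    (phat : ℝ) (K : Matrix (Fin m) (Fin n) ℝ) (ξ : ℝ) (X : Matrix (Fin n) (Fin n) ℝ) :
    Matrix (Fin n) (Fin n) ℝ :=
  lyapunovL Ah Bh d K (phat / (ξ + 1)) X

/-- The value at `x` of a matrix polynomial. -/
def evalMat {n : ℕ} (P : Matrix (Fin n) (Fin n) ℝ[X]) (x : ℝ) : Matrix (Fin n) (Fin n) ℝ :=
  P.map (Polynomial.eval x)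

/-- The degree of a matrix polynomial: the maximum of the degrees of its entries. -/
def matDegree {n : ℕ} (P : Matrix (Fin n) (Fin n) ℝ[X]) : ℕ :=
  Finset.univ.sup fun i => Finset.univ.sup fun j => (P i j).natDegree

/-- A matrix-valued function of a real variable is SOS if it is a finite sum `∑ Mᵢᵀ Mᵢ` with
matrix polynomials `Mᵢ` (in particular, it is then itself a matrix polynomial). -/
def IsSOS {n : ℕ} (F : ℝ → Matrix (Fin n) (Fin n) ℝ) : Prop :=
  ∃ (r : ℕ) (M : Fin r → Matrix (Fin n) (Fin n) ℝ[X]),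
    ∀ ξ : ℝ, F ξ = ∑ i, (evalMat (M i) ξ)ᵀ * evalMat (M i) ξ

/-- The sum-of-squares condition for the gain `K`. -/
def SOSCondition {n m : ℕ} (Ah : Matrix (Fin n) (Fin n) ℝ) (Bh : Matrix (Fin n) (Fin m) ℝ) (d : ℕ)
    (phat : ℝ) (K : Matrix (Fin m) (Fin n) ℝ) : Prop :=
  ∃ (P : Matrix (Fin n) (Fin n) ℝ[X]) (θ : ℝ) (ζ : ℕ), 0 < θ ∧ matDegree P ≤ ζ ∧
    IsSOS (fun ξ => evalMat P (ξ ^ 2) - ((ξ ^ 2 + 1) ^ ζ * θ) • (1 : Matrix (Fin n) (Fin n) ℝ)) ∧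
    IsSOS (fun ξ => (ξ ^ 2 + 1) • lyapunovH Ah Bh d phat K (ξ ^ 2) (evalMat P (ξ ^ 2)) -
      ((ξ ^ 2 + 1) ^ (ζ + 1) * θ) • (1 : Matrix (Fin n) (Fin n) ℝ))

end

/-! Let z_l = E[x_{l+d} | γ_0, …, γ_{l-1}]. Observing γ_l changes the prediction by the centred
innovation γ_l - (1-p), of variance p(1-p), carried through A_h^d, and the input due at time l+d is
B_h K z_l. Hence the second moments of z obey a delayed linear recursion with a(X) = F'XF, F = A_h +
(1-p)B_hK, and b(X) = p(1-p)G'XG, G = A_h^d B_h K (`predictedMoment_succ`), while L_K(p, ·) = 1 - a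
- b. The state tends to zero in mean square exactly when z does (`tendsto_closedLoop_iff`).

For a fixed rate, stability is equivalent to solvability of X > 0, L_K(p, X) > 0. A solution X
yields a Lyapunov functional with memory (`isStabilizedBy_of_lyapunov`). Conversely the moments are
governed by the coefficients of (1 - az - bz^{d+1})⁻¹; a long partial sum of these, applied to I, is
a solution because L_K maps it to I minus a small tail (`exists_lyapunov_of_isStabilizedBy`). Here
A_h is invertible, being an exponential.

Put p = phat·t with t in [0,1]. Solvability for every t gives a continuous solution by a partition
of unity, then a polynomial one by Weierstrass approximation (`exists_polynomial_lyapunov`). Under t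
= 1/(ξ²+1), multiplication by a high power of ξ²+1 gives matrix coefficients close to positive
multiples of values on [0,1], as in Bernstein's and Pólya's theorems, so the result is visibly SOS
(`eventually_isSOS_of_pos`). In the other direction SOS matrices are positive semidefinite, which
settles t in (0,1]; the margin θ and the bound deg P ≤ ζ let the inequalities pass to the limit t =
0 (`exists_lyapunov_of_sosCondition`). -/

/-! ### Dropout processes -/

section Dropout

variable {Ω : Type*} [MeasurableSpace Ω] {μ : Measure Ω} {γ : ℕ → Ω → ℝ} {p : ℝ}

theorem history_mono (γ : ℕ → Ω → ℝ) {k l : ℕ} (h : k ≤ l) : history γ k ≤ history γ l :=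
  iSup₂_le fun j hj => le_iSup₂_of_le j (hj.trans_le h) le_rfl

theorem history_le (hγ : ∀ k, Measurable (γ k)) (k : ℕ) :
    history γ k ≤ (inferInstance : MeasurableSpace Ω) :=
  iSup₂_le fun j _ => (hγ j).comap_le

theorem measurable_history (γ : ℕ → Ω → ℝ) {j k : ℕ} (h : j < k) :
    Measurable[history γ k] (γ j) :=
  Measurable.mono (comap_measurable (γ j)) (le_iSup₂_of_le j h le_rfl) le_rfl

/-- Essentially bounded real random variables that depend on `γ 0, …, γ (k - 1)` only. -/
structure BoundedAdapted (μ : Measure Ω) (γ : ℕ → Ω → ℝ) (k : ℕ) (f : Ω → ℝ) : Prop where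
  measurable : Measurable[history γ k] f
  memLp : MemLp f ⊤ μ

namespace BoundedAdapted

variable {k l : ℕ} {f g : Ω → ℝ}

theorem mono (hf : BoundedAdapted μ γ k f) (h : k ≤ l) : BoundedAdapted μ γ l f :=
  ⟨hf.measurable.mono (history_mono γ h) le_rfl, hf.memLp⟩

theorem add (hf : BoundedAdapted μ γ k f) (hg : BoundedAdapted μ γ k g) :
    BoundedAdapted μ γ k (fun ω => f ω + g ω) :=
  ⟨hf.measurable.add hg.measurable, hf.memLp.add hg.memLp⟩

theorem mul (hf : BoundedAdapted μ γ k f) (hg : BoundedAdapted μ γ k g) :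
    BoundedAdapted μ γ k (fun ω => f ω * g ω) :=
  ⟨hf.measurable.mul hg.measurable, hg.memLp.mul hf.memLp⟩

theorem const [IsFiniteMeasure μ] (c : ℝ) : BoundedAdapted μ γ k (fun _ => c) :=
  ⟨measurable_const, memLp_const c⟩

theorem const_mul (c : ℝ) (hf : BoundedAdapted μ γ k f) :
    BoundedAdapted μ γ k (fun ω => c * f ω) :=
  ⟨hf.measurable.const_mul c, hf.memLp.const_mul c⟩

theorem sum {ι : Type*} (s : Finset ι) {F : ι → Ω → ℝ}
    (hF : ∀ i ∈ s, BoundedAdapted μ γ k (F i)) :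
    BoundedAdapted μ γ k (fun ω => ∑ i ∈ s, F i ω) :=
  ⟨Finset.measurable_fun_sum s fun i hi => (hF i hi).measurable,
    memLp_finsetSum s fun i hi => (hF i hi).memLp⟩

theorem integrable [IsFiniteMeasure μ] (hf : BoundedAdapted μ γ k f) : Integrable f μ :=
  hf.memLp.integrable le_top

theorem mulVec {n m : ℕ} (M : Matrix (Fin n) (Fin m) ℝ) {x : Ω → Fin m → ℝ}
    (hx : ∀ i, BoundedAdapted μ γ k (fun ω => x ω i)) (i : Fin n) :
    BoundedAdapted μ γ k (fun ω => (M *ᵥ x ω) i) :=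
  sum Finset.univ fun j _ => (hx j).const_mul (M i j)

theorem dotProduct {n : ℕ} {x y : Ω → Fin n → ℝ}
    (hx : ∀ i, BoundedAdapted μ γ k (fun ω => x ω i))
    (hy : ∀ i, BoundedAdapted μ γ k (fun ω => y ω i)) :
    BoundedAdapted μ γ k (fun ω => x ω ⬝ᵥ y ω) :=
  sum Finset.univ fun j _ => (hx j).mul (hy j)

theorem indicator [IsFiniteMeasure μ] {s : Set Ω} (hγ : ∀ k, Measurable (γ k))
    (hs : MeasurableSet[history γ k] s) :
    BoundedAdapted μ γ k (s.indicator fun _ => 1) :=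
  ⟨measurable_const.indicator hs, (memLp_const 1).indicator (history_le hγ k s hs)⟩

end BoundedAdapted

namespace IsDropoutProcess

variable [IsProbabilityMeasure μ]

theorem ae_zero_or_one (hγ : IsDropoutProcess p μ γ) (hp0 : 0 ≤ p) (hp1 : p ≤ 1) (k : ℕ) :
    ∀ᵐ ω ∂μ, γ k ω = 0 ∨ γ k ω = 1 := by
  have h0 : MeasurableSet {ω | γ k ω = 0} := hγ.measurable k (measurableSet_singleton 0)
  have h1 : MeasurableSet {ω | γ k ω = 1} := hγ.measurable k (measurableSet_singleton 1)
  have hd : Disjoint {ω | γ k ω = 0} {ω | γ k ω = 1} := by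
    rw [Set.disjoint_left]
    intro ω h h'
    simp only [Set.mem_ofPred_eq] at h h'
    rw [h] at h'
    exact zero_ne_one h'
  have hu : μ ({ω | γ k ω = 0} ∪ {ω | γ k ω = 1}) = 1 := by
    rw [measure_union hd h1, hγ.prob_zero, hγ.prob_one, ← ENNReal.ofReal_add hp0 (by linarith)]
    simp
  have := (prob_compl_eq_zero_iff (h0.union h1)).2 hu
  rw [ae_iff]
  convert this using 2
  ext ω
  simp

theorem memLp_top (hγ : IsDropoutProcess p μ γ) (hp0 : 0 ≤ p) (hp1 : p ≤ 1) (k : ℕ) :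
    MemLp (γ k) ⊤ μ := by
  refine memLp_top_of_bound (hγ.measurable k).aestronglyMeasurable 1 ?_
  filter_upwards [hγ.ae_zero_or_one hp0 hp1 k] with ω h
  rcases h with h | h <;> simp [h]

theorem boundedAdapted (hγ : IsDropoutProcess p μ γ) (hp0 : 0 ≤ p) (hp1 : p ≤ 1) (k : ℕ) :
    BoundedAdapted μ γ (k + 1) (γ k) :=
  ⟨measurable_history γ k.lt_succ_self, hγ.memLp_top hp0 hp1 k⟩

theorem integral_eq (hγ : IsDropoutProcess p μ γ) (hp0 : 0 ≤ p) (hp1 : p ≤ 1) (k : ℕ) :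
    ∫ ω, γ k ω ∂μ = 1 - p := by
  have h1 : MeasurableSet {ω | γ k ω = 1} := hγ.measurable k (measurableSet_singleton 1)
  have : γ k =ᵐ[μ] {ω | γ k ω = 1}.indicator fun _ => (1 : ℝ) := by
    filter_upwards [hγ.ae_zero_or_one hp0 hp1 k] with ω h
    rcases h with h | h <;> simp [h, Set.indicator]
  rw [integral_congr_ae this, integral_indicator_const _ h1, measureReal_def, hγ.prob_one,
    ENNReal.toReal_ofReal (by linarith)]
  simp

theorem indepFun_of_boundedAdapted (hγ : IsDropoutProcess p μ γ) {k : ℕ} {f : Ω → ℝ}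
    (hf : BoundedAdapted μ γ k f) : IndepFun (γ k) f μ := by
  have h := indep_iSup_of_disjoint (fun i => (hγ.measurable i).comap_le) hγ.indep.iIndep
    (S := {k}) (T := {j | j < k}) (by simp)
  rw [iSup_singleton] at h
  exact indep_of_indep_of_le_right h hf.measurable.comap_le

theorem integral_mul (hγ : IsDropoutProcess p μ γ) (hp0 : 0 ≤ p) (hp1 : p ≤ 1) {k : ℕ}
    {f : Ω → ℝ} (hf : BoundedAdapted μ γ k f) :
    ∫ ω, γ k ω * f ω ∂μ = (1 - p) * ∫ ω, f ω ∂μ := by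
  rw [(hγ.indepFun_of_boundedAdapted hf).integral_fun_mul_eq_mul_integral
    (hγ.measurable k).aestronglyMeasurable hf.integrable.aestronglyMeasurable,
    hγ.integral_eq hp0 hp1]

theorem integral_sq_add (hγ : IsDropoutProcess p μ γ) (hp0 : 0 ≤ p) (hp1 : p ≤ 1) {k : ℕ}
    {f g e : Ω → ℝ} (hf : BoundedAdapted μ γ k f) (hg : BoundedAdapted μ γ k g)
    (he : BoundedAdapted μ γ k e) :
    ∫ ω, f ω + (γ k ω - (1 - p)) * g ω + (γ k ω - (1 - p)) ^ 2 * e ω ∂μ =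
      ∫ ω, f ω ∂μ + p * (1 - p) * ∫ ω, e ω ∂μ := by
  have hb := hγ.boundedAdapted hp0 hp1 k
  -- As γ² = γ almost surely, the integrand is affine in `γ k`, so the mean of `γ k` and its
  -- independence of the past suffice.
  have h1 : (fun ω => f ω + (γ k ω - (1 - p)) * g ω + (γ k ω - (1 - p)) ^ 2 * e ω) =ᵐ[μ]
      fun ω => (f ω + (-(1 - p)) * g ω + (1 - p) ^ 2 * e ω) +
        γ k ω * (g ω + (1 - 2 * (1 - p)) * e ω) := by
    filter_upwards [hγ.ae_zero_or_one hp0 hp1 k] with ω h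
    rcases h with h | h <;> rw [h] <;> ring
  have hc : BoundedAdapted μ γ k (fun ω => g ω + (1 - 2 * (1 - p)) * e ω) :=
    hg.add (he.const_mul _)
  have hfg : BoundedAdapted μ γ k (fun ω => f ω + (-(1 - p)) * g ω) := hf.add (hg.const_mul _)
  rw [integral_congr_ae h1, integral_add (hfg.add (he.const_mul _)).integrable
      (hb.mul (hc.mono k.le_succ)).integrable, hγ.integral_mul hp0 hp1 hc,
    integral_add hfg.integrable (he.const_mul _).integrable,
    integral_add hf.integrable (hg.const_mul _).integrable,
    integral_add hg.integrable (he.const_mul _).integrable, integral_const_mul,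
    integral_const_mul, integral_const_mul]
  ring

/-- A centred innovation `γ k` adds its variance to every quadratic form. -/
theorem integral_quadratic_innovation (hγ : IsDropoutProcess p μ γ) (hp0 : 0 ≤ p) (hp1 : p ≤ 1)
    {k n : ℕ} (X : Matrix (Fin n) (Fin n) ℝ) {a b : Ω → Fin n → ℝ}
    (ha : ∀ i, BoundedAdapted μ γ k (fun ω => a ω i))
    (hb : ∀ i, BoundedAdapted μ γ k (fun ω => b ω i)) :
    ∫ ω, (a ω + (γ k ω - (1 - p)) • b ω) ⬝ᵥ (X *ᵥ (a ω + (γ k ω - (1 - p)) • b ω)) ∂μ =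
      ∫ ω, a ω ⬝ᵥ (X *ᵥ a ω) ∂μ + p * (1 - p) * ∫ ω, b ω ⬝ᵥ (X *ᵥ b ω) ∂μ := by
  rw [← hγ.integral_sq_add hp0 hp1 (BoundedAdapted.dotProduct ha (BoundedAdapted.mulVec X ha))
    ((BoundedAdapted.dotProduct ha (BoundedAdapted.mulVec X hb)).add
      (BoundedAdapted.dotProduct hb (BoundedAdapted.mulVec X ha)))
    (BoundedAdapted.dotProduct hb (BoundedAdapted.mulVec X hb))]
  congr 1
  ext ω
  simp only [mulVec_add, mulVec_smul, dotProduct_add, add_dotProduct, dotProduct_smul,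
    smul_dotProduct, smul_eq_mul]
  ring

end IsDropoutProcess

end Dropout

/-! ### Predictors -/

section Predictor

variable {Ω : Type*} {n : ℕ}

/-- The mean value of `x (l + i)` seen from time `l`, when `x (k + 1) = A x k + γ k v k` and each
`γ k` has mean `q`. -/
def predictor (A : Matrix (Fin n) (Fin n) ℝ) (q : ℝ) (x v : ℕ → Ω → Fin n → ℝ) (l : ℕ) :
    ℕ → Ω → Fin n → ℝ
  | 0 => x l
  | i + 1 => fun ω => A *ᵥ predictor A q x v l i ω + q • v (l + i) ω

variable {A : Matrix (Fin n) (Fin n) ℝ} {q : ℝ} {x v : ℕ → Ω → Fin n → ℝ} {γ : ℕ → Ω → ℝ}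

theorem predictor_succ (l i : ℕ) (ω : Ω) :
    predictor A q x v l (i + 1) ω = A *ᵥ predictor A q x v l i ω + q • v (l + i) ω := rfl

/-- Learning γ_l corrects the forecast only by the innovation γ_l - q, which the remaining i steps
propagate by A^i. -/
theorem predictor_succ_left (hx : ∀ k ω, x (k + 1) ω = A *ᵥ x k ω + γ k ω • v k ω) (l i : ℕ)
    (ω : Ω) :
    predictor A q x v (l + 1) i ω =
      predictor A q x v l (i + 1) ω + (γ l ω - q) • ((A ^ i) *ᵥ v l ω) := by
  induction i with
  | zero =>
    simp only [predictor, hx, pow_zero, one_mulVec, Nat.add_zero, sub_smul]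
    abel
  | succ i ih =>
    rw [predictor_succ, ih, predictor_succ l (i + 1)]
    simp only [mulVec_add, mulVec_smul, mulVec_mulVec, ← pow_succ']
    rw [show l + 1 + i = l + (i + 1) by ring]
    abel

variable [MeasurableSpace Ω] {μ : Measure Ω} [IsProbabilityMeasure μ] {p : ℝ} {d : ℕ}

/-- The horizon d + 1 is the longest for which every input involved is already fixed by the history
at time l. -/
theorem boundedAdapted_predictor (l : ℕ)
    (hx : ∀ c, BoundedAdapted μ γ l (fun ω => x l ω c)) (i : ℕ) (hi : i ≤ d + 1)
    (hv : ∀ j, j < i → ∀ c, BoundedAdapted μ γ (l + j - d) (fun ω => v (l + j) ω c)) (c : Fin n) :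
    BoundedAdapted μ γ l (fun ω => predictor A q x v l i ω c) := by
  induction i generalizing c with
  | zero => exact hx c
  | succ i ih =>
    exact (BoundedAdapted.mulVec A (ih (by omega) fun j hj => hv j (by omega)) c).add
      (((hv i (by omega) c).mono (by omega)).const_mul q)

theorem condExp_eq_predictor (hγ : IsDropoutProcess p μ γ) (hp0 : 0 ≤ p) (hp1 : p ≤ 1)
    (hx : ∀ k ω, x (k + 1) ω = A *ᵥ x k ω + γ k ω • v k ω)
    (hxb : ∀ k c, BoundedAdapted μ γ k (fun ω => x k ω c))
    (hvb : ∀ k c, BoundedAdapted μ γ (k - d) (fun ω => v k ω c)) (l : ℕ) (i : ℕ) (hi : i ≤ d + 1) :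
    μ[x (l + i) | history γ l] =ᵐ[μ] predictor A (1 - p) x v l i := by
  have hpred : ∀ i ≤ d + 1, ∀ c,
      BoundedAdapted μ γ l (fun ω => predictor A (1 - p) x v l i ω c) := fun i hi =>
    boundedAdapted_predictor l (hxb l) i hi fun j _ => hvb (l + j)
  -- The defining identity of the conditional expectation, tested against all bounded adapted g; in
  -- the induction γ_{l+i} is independent of g·v_{l+i}. Indicators are inserted for g at the end.
  have key : ∀ g : Ω → ℝ, BoundedAdapted μ γ l g → ∀ i ≤ d + 1, ∀ c,
      ∫ ω, g ω * x (l + i) ω c ∂μ = ∫ ω, g ω * predictor A (1 - p) x v l i ω c ∂μ := by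
    intro g hg i
    induction i with
    | zero => intro _ c; rfl
    | succ i ih =>
      intro hi c
      have hv : BoundedAdapted μ γ l (fun ω => v (l + i) ω c) := (hvb (l + i) c).mono (by omega)
      have hgv := hg.mul hv
      have hgx : ∀ j, BoundedAdapted μ γ (l + i) (fun ω => A c j * (g ω * x (l + i) ω j)) :=
        fun j => ((hg.mono (by omega)).mul (hxb (l + i) j)).const_mul _
      have hgp : ∀ j, BoundedAdapted μ γ l
          (fun ω => A c j * (g ω * predictor A (1 - p) x v l i ω j)) :=
        fun j => (hg.mul (hpred i (by omega) j)).const_mul _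
      have e1 : ∀ ω, g ω * x (l + (i + 1)) ω c =
          ∑ j, A c j * (g ω * x (l + i) ω j) + γ (l + i) ω * (g ω * v (l + i) ω c) := by
        intro ω
        rw [← add_assoc, hx]
        simp only [Pi.add_apply, Pi.smul_apply, smul_eq_mul, mul_add, mulVec, dotProduct,
          Finset.mul_sum]
        congr 1
        · exact Finset.sum_congr rfl fun j _ => by ring
        · ring
      have e2 : ∀ ω, g ω * predictor A (1 - p) x v l (i + 1) ω c =
          ∑ j, A c j * (g ω * predictor A (1 - p) x v l i ω j) +
            (1 - p) * (g ω * v (l + i) ω c) := by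
        intro ω
        simp only [predictor, Pi.add_apply, Pi.smul_apply, smul_eq_mul, mul_add, mulVec,
          dotProduct, Finset.mul_sum]
        congr 1
        · exact Finset.sum_congr rfl fun j _ => by ring
        · ring
      simp only [e1, e2]
      rw [integral_add (BoundedAdapted.sum _ fun j _ => hgx j).integrable
          ((hγ.boundedAdapted hp0 hp1 (l + i)).mul (hgv.mono (by omega))).integrable,
        integral_add (BoundedAdapted.sum _ fun j _ => hgp j).integrable
          (hgv.const_mul _).integrable,
        integral_finsetSum _ fun j _ => (hgx j).integrable,
        integral_finsetSum _ fun j _ => (hgp j).integrable,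
        hγ.integral_mul hp0 hp1 (hgv.mono (by omega)), integral_const_mul]
      simp only [integral_const_mul, ih (by omega)]
  refine (ae_eq_condExp_of_forall_setIntegral_eq (history_le hγ.measurable l)
    (Integrable.of_eval fun c => (hxb (l + i) c).integrable)
    (fun s _ _ => (Integrable.of_eval fun c => (hpred i hi c).integrable).integrableOn)
    (fun s hs _ => ?_) ?_).symm
  · ext c
    rw [eval_integral fun c => (hpred i hi c).integrable.integrableOn,
      eval_integral fun c => (hxb (l + i) c).integrable.integrableOn]
    have hs' := history_le hγ.measurable l s hs
    rw [← integral_indicator hs', ← integral_indicator hs']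
    have := key _ (BoundedAdapted.indicator hγ.measurable hs) i hi c
    have hmul : ∀ (f : Ω → ℝ) ω, s.indicator (fun _ => 1) ω * f ω = s.indicator f ω := by
      intro f ω
      by_cases h : ω ∈ s <;> simp [h]
    rw [funext (hmul _), funext (hmul _)] at this
    exact this.symm
  · exact ((@measurable_pi_iff _ _ _ (history γ l) _ _).2
      fun c => (hpred i hi c).measurable).stronglyMeasurable.aestronglyMeasurable

end Predictor

/-! ### Quadratic forms of matrices -/

section QuadraticForm

variable {n : ℕ}

theorem quadratic_conj {m : ℕ} (M : Matrix (Fin m) (Fin n) ℝ) (X : Matrix (Fin m) (Fin m) ℝ)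
    (v : Fin n → ℝ) : (M *ᵥ v) ⬝ᵥ (X *ᵥ (M *ᵥ v)) = v ⬝ᵥ ((Mᵀ * X * M) *ᵥ v) := by
  rw [← mulVec_mulVec, ← mulVec_mulVec, dotProduct_mulVec v, vecMul_transpose]

theorem abs_quadratic_le {X : Matrix (Fin n) (Fin n) ℝ} {ε : ℝ} (hX : ∀ i j, |X i j| ≤ ε)
    (v : Fin n → ℝ) : |v ⬝ᵥ (X *ᵥ v)| ≤ n * ε * (v ⬝ᵥ v) := by
  have hsq : ∀ i j, |v i| * |v j| ≤ (v i ^ 2 + v j ^ 2) / 2 := fun i j => by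
    nlinarith [sq_nonneg (|v i| - |v j|), sq_abs (v i), sq_abs (v j)]
  calc |v ⬝ᵥ (X *ᵥ v)| = |∑ i, ∑ j, v i * (X i j * v j)| := by
        simp only [dotProduct, mulVec, Finset.mul_sum]
    _ ≤ ∑ i, ∑ j, |v i * (X i j * v j)| :=
        (Finset.abs_sum_le_sum_abs _ _).trans
          (Finset.sum_le_sum fun i _ => Finset.abs_sum_le_sum_abs _ _)
    _ ≤ ∑ i : Fin n, ∑ j : Fin n, ε * ((v i ^ 2 + v j ^ 2) / 2) := by
        refine Finset.sum_le_sum fun i _ => Finset.sum_le_sum fun j _ => ?_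
        rw [abs_mul, abs_mul]
        calc |v i| * (|X i j| * |v j|) = |X i j| * (|v i| * |v j|) := by ring
          _ ≤ ε * ((v i ^ 2 + v j ^ 2) / 2) :=
            mul_le_mul (hX i j) (hsq i j) (by positivity) ((abs_nonneg _).trans (hX i j))
    _ = n * ε * (v ⬝ᵥ v) := by
        simp only [← Finset.mul_sum, ← Finset.sum_div, Finset.sum_add_distrib, Finset.sum_const,
          Finset.card_univ, Fintype.card_fin, nsmul_eq_mul, dotProduct, pow_two]
        simp only [mul_left_comm _ (n : ℝ), ← Finset.mul_sum]
        ring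

theorem exists_abs_quadratic_le (X : Matrix (Fin n) (Fin n) ℝ) :
    ∃ C : ℝ, 0 ≤ C ∧ ∀ v : Fin n → ℝ, |v ⬝ᵥ (X *ᵥ v)| ≤ C * (v ⬝ᵥ v) := by
  refine ⟨n * ∑ i, ∑ j, |X i j|, by positivity, abs_quadratic_le fun i j => ?_⟩
  exact (Finset.single_le_sum (f := fun j => |X i j|) (fun _ _ => abs_nonneg _)
    (Finset.mem_univ j)).trans (Finset.single_le_sum (f := fun i => ∑ j, |X i j|)
    (fun _ _ => Finset.sum_nonneg fun _ _ => abs_nonneg _) (Finset.mem_univ i))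

end QuadraticForm

/-! ### Second moments of the predicted state -/

section ClosedLoop

variable {Ω : Type*} [MeasurableSpace Ω] {n m : ℕ}

/-- The control input `B_h u_{k-d}` which is due at time `k`. -/
noncomputable def plantInput (μ : Measure Ω) (γ : ℕ → Ω → ℝ) (Ah : Matrix (Fin n) (Fin n) ℝ)
    (Bh : Matrix (Fin n) (Fin m) ℝ) (d : ℕ) (K : Matrix (Fin m) (Fin n) ℝ) (x₀ : Fin n → ℝ)
    (φ : Fin d → Fin m → ℝ) (k : ℕ) (ω : Ω) : Fin n → ℝ :=
  Bh *ᵥ (if hk : k < d then φ ⟨k, hk⟩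
    else K *ᵥ (μ[closedLoop μ γ Ah Bh d K x₀ φ k | history γ (k - d)]) ω)

/-- The predicted state `E[x (l + d) | γ 0, …, γ (l - 1)]`. -/
noncomputable def predictedState (p : ℝ) (μ : Measure Ω) (γ : ℕ → Ω → ℝ) (Ah : Matrix (Fin n) (Fin n) ℝ)
    (Bh : Matrix (Fin n) (Fin m) ℝ) (d : ℕ) (K : Matrix (Fin m) (Fin n) ℝ) (x₀ : Fin n → ℝ)
    (φ : Fin d → Fin m → ℝ) (l : ℕ) : Ω → Fin n → ℝ :=
  predictor Ah (1 - p) (closedLoop μ γ Ah Bh d K x₀ φ) (plantInput μ γ Ah Bh d K x₀ φ) l d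

/-- The expected value of the quadratic form `X` at the predicted state. -/
noncomputable def predictedMoment (p : ℝ) (μ : Measure Ω) (γ : ℕ → Ω → ℝ) (Ah : Matrix (Fin n) (Fin n) ℝ)
    (Bh : Matrix (Fin n) (Fin m) ℝ) (d : ℕ) (K : Matrix (Fin m) (Fin n) ℝ) (x₀ : Fin n → ℝ)
    (φ : Fin d → Fin m → ℝ) (l : ℕ) (X : Matrix (Fin n) (Fin n) ℝ) : ℝ :=
  ∫ ω, predictedState p μ γ Ah Bh d K x₀ φ l ω ⬝ᵥ
    (X *ᵥ predictedState p μ γ Ah Bh d K x₀ φ l ω) ∂μ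

variable {p : ℝ} {μ : Measure Ω} {γ : ℕ → Ω → ℝ} [IsProbabilityMeasure μ]
  {Ah : Matrix (Fin n) (Fin n) ℝ} {Bh : Matrix (Fin n) (Fin m) ℝ} {d : ℕ}
  {K : Matrix (Fin m) (Fin n) ℝ} {x₀ : Fin n → ℝ} {φ : Fin d → Fin m → ℝ}

theorem closedLoop_succ (k : ℕ) (ω : Ω) :
    closedLoop μ γ Ah Bh d K x₀ φ (k + 1) ω = Ah *ᵥ closedLoop μ γ Ah Bh d K x₀ φ k ω +
      γ k ω • plantInput μ γ Ah Bh d K x₀ φ k ω := rfl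

theorem plantInput_of_lt {k : ℕ} (hk : k < d) (ω : Ω) :
    plantInput μ γ Ah Bh d K x₀ φ k ω = Bh *ᵥ φ ⟨k, hk⟩ := by
  rw [plantInput, dif_pos hk]

/-- Half of an alternating induction: regularity of x_k passes to the input at time k, hence to
x_{k+1}. Conditional expectation preserves essential boundedness. -/
theorem boundedAdapted_plantInput_of_closedLoop {k : ℕ}
    (hx : ∀ c, BoundedAdapted μ γ k (fun ω => closedLoop μ γ Ah Bh d K x₀ φ k ω c)) (c : Fin n) :
    BoundedAdapted μ γ (k - d) (fun ω => plantInput μ γ Ah Bh d K x₀ φ k ω c) := by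
  refine BoundedAdapted.mulVec Bh (fun i => ?_) c
  by_cases hk : k < d
  · simp only [dif_pos hk]
    exact BoundedAdapted.const _
  · simp only [dif_neg hk]
    refine BoundedAdapted.mulVec K (fun i => ⟨?_, ?_⟩) i
    · exact (@measurable_pi_iff _ _ _ (history γ (k - d)) _ _).1
        stronglyMeasurable_condExp.measurable i
    · exact ((MemLp.of_eval fun c => (hx c).memLp).condExp le_top).eval i

theorem boundedAdapted_closedLoop (hγ : IsDropoutProcess p μ γ) (hp0 : 0 ≤ p) (hp1 : p ≤ 1)
    (k : ℕ) (c : Fin n) :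
    BoundedAdapted μ γ k (fun ω => closedLoop μ γ Ah Bh d K x₀ φ k ω c) := by
  induction k generalizing c with
  | zero => exact BoundedAdapted.const _
  | succ k ih =>
    exact ((BoundedAdapted.mulVec Ah ih c).mono k.le_succ).add
      ((hγ.boundedAdapted hp0 hp1 k).mul
        ((boundedAdapted_plantInput_of_closedLoop ih c).mono (by omega)))

theorem boundedAdapted_plantInput (hγ : IsDropoutProcess p μ γ) (hp0 : 0 ≤ p) (hp1 : p ≤ 1)
    (k : ℕ) (c : Fin n) :
    BoundedAdapted μ γ (k - d) (fun ω => plantInput μ γ Ah Bh d K x₀ φ k ω c) :=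
  boundedAdapted_plantInput_of_closedLoop (boundedAdapted_closedLoop hγ hp0 hp1 k) c

theorem boundedAdapted_predictedState (hγ : IsDropoutProcess p μ γ) (hp0 : 0 ≤ p) (hp1 : p ≤ 1)
    (l : ℕ) (c : Fin n) :
    BoundedAdapted μ γ l (fun ω => predictedState p μ γ Ah Bh d K x₀ φ l ω c) :=
  boundedAdapted_predictor (d := d) l (boundedAdapted_closedLoop hγ hp0 hp1 l) d d.le_succ
    (fun j _ => boundedAdapted_plantInput hγ hp0 hp1 (l + j)) c

/-- This closes the loop: from time d on, the inputs are linear functions of earlier predicted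
states. -/
theorem plantInput_ae_eq (hγ : IsDropoutProcess p μ γ) (hp0 : 0 ≤ p) (hp1 : p ≤ 1) (l : ℕ) :
    ∀ᵐ ω ∂μ, plantInput μ γ Ah Bh d K x₀ φ (l + d) ω =
      (Bh * K) *ᵥ predictedState p μ γ Ah Bh d K x₀ φ l ω := by
  filter_upwards [condExp_eq_predictor (d := d) hγ hp0 hp1 closedLoop_succ
    (boundedAdapted_closedLoop (Ah := Ah) (Bh := Bh) (K := K) (x₀ := x₀) (φ := φ) hγ hp0 hp1)
    (boundedAdapted_plantInput hγ hp0 hp1) l d d.le_succ] with ω hω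
  rw [plantInput, dif_neg (by omega), Nat.add_sub_cancel, hω, mulVec_mulVec]
  rfl

theorem integral_predictor_succ_left (hγ : IsDropoutProcess p μ γ) (hp0 : 0 ≤ p) (hp1 : p ≤ 1)
    (X : Matrix (Fin n) (Fin n) ℝ) (l i : ℕ) (hi : i ≤ d) :
    let P := predictor Ah (1 - p) (closedLoop μ γ Ah Bh d K x₀ φ)
      (plantInput μ γ Ah Bh d K x₀ φ)
    ∫ ω, P (l + 1) i ω ⬝ᵥ (X *ᵥ P (l + 1) i ω) ∂μ =
      ∫ ω, P l (i + 1) ω ⬝ᵥ (X *ᵥ P l (i + 1) ω) ∂μ + p * (1 - p) *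
        ∫ ω, ((Ah ^ i) *ᵥ plantInput μ γ Ah Bh d K x₀ φ l ω) ⬝ᵥ
          (X *ᵥ ((Ah ^ i) *ᵥ plantInput μ γ Ah Bh d K x₀ φ l ω)) ∂μ := by
  intro P
  rw [← hγ.integral_quadratic_innovation hp0 hp1 X
    (boundedAdapted_predictor (d := d) l (boundedAdapted_closedLoop hγ hp0 hp1 l) (i + 1)
      (by omega) fun j _ => boundedAdapted_plantInput hγ hp0 hp1 (l + j))
    (BoundedAdapted.mulVec (Ah ^ i) fun c =>
      (boundedAdapted_plantInput hγ hp0 hp1 l c).mono (Nat.sub_le l d))]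
  simp only [P, predictor_succ_left closedLoop_succ]

theorem integral_plantInput (hγ : IsDropoutProcess p μ γ) (hp0 : 0 ≤ p) (hp1 : p ≤ 1)
    (M X : Matrix (Fin n) (Fin n) ℝ) (l : ℕ) :
    ∫ ω, (M *ᵥ plantInput μ γ Ah Bh d K x₀ φ (l + d) ω) ⬝ᵥ
        (X *ᵥ (M *ᵥ plantInput μ γ Ah Bh d K x₀ φ (l + d) ω)) ∂μ =
      predictedMoment p μ γ Ah Bh d K x₀ φ l ((M * (Bh * K))ᵀ * X * (M * (Bh * K))) := by
  refine integral_congr_ae ?_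
  filter_upwards [plantInput_ae_eq hγ hp0 hp1 l] with ω hω
  rw [hω, mulVec_mulVec, quadratic_conj]

theorem integral_predictor_step (hγ : IsDropoutProcess p μ γ) (hp0 : 0 ≤ p) (hp1 : p ≤ 1)
    (X : Matrix (Fin n) (Fin n) ℝ) (l : ℕ) :
    let P := predictor Ah (1 - p) (closedLoop μ γ Ah Bh d K x₀ φ)
      (plantInput μ γ Ah Bh d K x₀ φ)
    ∫ ω, P l (d + 1) ω ⬝ᵥ (X *ᵥ P l (d + 1) ω) ∂μ =
      predictedMoment p μ γ Ah Bh d K x₀ φ l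
        ((Ah + (1 - p) • (Bh * K))ᵀ * X * (Ah + (1 - p) • (Bh * K))) := by
  intro P
  refine integral_congr_ae ?_
  filter_upwards [plantInput_ae_eq hγ hp0 hp1 l] with ω hω
  rw [← quadratic_conj, add_mulVec, smul_mulVec, ← hω]
  rfl

theorem predictedMoment_succ (hγ : IsDropoutProcess p μ γ) (hp0 : 0 ≤ p) (hp1 : p ≤ 1)
    (X : Matrix (Fin n) (Fin n) ℝ) (l : ℕ) :
    predictedMoment p μ γ Ah Bh d K x₀ φ (l + d + 1) X =
      predictedMoment p μ γ Ah Bh d K x₀ φ (l + d)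
        ((Ah + (1 - p) • (Bh * K))ᵀ * X * (Ah + (1 - p) • (Bh * K))) +
      p * (1 - p) * predictedMoment p μ γ Ah Bh d K x₀ φ l
        ((Ah ^ d * (Bh * K))ᵀ * X * (Ah ^ d * (Bh * K))) := by
  rw [← integral_predictor_step hγ hp0 hp1, ← integral_plantInput hγ hp0 hp1]
  exact integral_predictor_succ_left hγ hp0 hp1 X (l + d) d le_rfl

/-- With zero initial inputs there is no innovation before time d, so the delayed term is absent. -/
theorem predictedMoment_succ_of_lt (hγ : IsDropoutProcess p μ γ) (hp0 : 0 ≤ p) (hp1 : p ≤ 1)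
    (X : Matrix (Fin n) (Fin n) ℝ) {l : ℕ} (hl : l < d) :
    predictedMoment p μ γ Ah Bh d K x₀ 0 (l + 1) X =
      predictedMoment p μ γ Ah Bh d K x₀ 0 l
        ((Ah + (1 - p) • (Bh * K))ᵀ * X * (Ah + (1 - p) • (Bh * K))) := by
  rw [← integral_predictor_step hγ hp0 hp1]
  refine (integral_predictor_succ_left hγ hp0 hp1 X l d le_rfl).trans ?_
  simp [plantInput_of_lt hl]

theorem predictedMoment_zero (X : Matrix (Fin n) (Fin n) ℝ) :
    predictedMoment p μ γ Ah Bh d K x₀ 0 0 X =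
      ((Ah ^ d) *ᵥ x₀) ⬝ᵥ (X *ᵥ ((Ah ^ d) *ᵥ x₀)) := by
  have key : ∀ i ≤ d, ∀ ω, predictor Ah (1 - p) (closedLoop μ γ Ah Bh d K x₀ 0)
      (plantInput μ γ Ah Bh d K x₀ 0) 0 i ω = (Ah ^ i) *ᵥ x₀ := by
    intro i hi ω
    induction i with
    | zero => simp [predictor, closedLoop]
    | succ i ih =>
      rw [predictor_succ, ih (by omega), plantInput_of_lt (by omega), mulVec_mulVec, pow_succ']
      simp
  simp [predictedMoment, predictedState, key d le_rfl]

theorem integrable_predictedState (hγ : IsDropoutProcess p μ γ) (hp0 : 0 ≤ p) (hp1 : p ≤ 1)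
    (l : ℕ) (X : Matrix (Fin n) (Fin n) ℝ) :
    Integrable (fun ω => predictedState p μ γ Ah Bh d K x₀ φ l ω ⬝ᵥ
      (X *ᵥ predictedState p μ γ Ah Bh d K x₀ φ l ω)) μ :=
  (BoundedAdapted.dotProduct (boundedAdapted_predictedState hγ hp0 hp1 l)
    (BoundedAdapted.mulVec X (boundedAdapted_predictedState hγ hp0 hp1 l))).integrable

theorem predictedMoment_add (hγ : IsDropoutProcess p μ γ) (hp0 : 0 ≤ p) (hp1 : p ≤ 1)
    (l : ℕ) (X Y : Matrix (Fin n) (Fin n) ℝ) :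
    predictedMoment p μ γ Ah Bh d K x₀ φ l (X + Y) =
      predictedMoment p μ γ Ah Bh d K x₀ φ l X + predictedMoment p μ γ Ah Bh d K x₀ φ l Y := by
  unfold predictedMoment
  rw [← integral_add (integrable_predictedState hγ hp0 hp1 l X)
    (integrable_predictedState hγ hp0 hp1 l Y)]
  simp only [add_mulVec, dotProduct_add]

theorem predictedMoment_smul (l : ℕ) (c : ℝ) (X : Matrix (Fin n) (Fin n) ℝ) :
    predictedMoment p μ γ Ah Bh d K x₀ φ l (c • X) =
      c * predictedMoment p μ γ Ah Bh d K x₀ φ l X := by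
  simp only [predictedMoment, smul_mulVec, dotProduct_smul, smul_eq_mul, integral_const_mul]

theorem predictedMoment_mono (hγ : IsDropoutProcess p μ γ) (hp0 : 0 ≤ p) (hp1 : p ≤ 1)
    (l : ℕ) {X Y : Matrix (Fin n) (Fin n) ℝ}
    (h : ∀ v : Fin n → ℝ, v ⬝ᵥ (X *ᵥ v) ≤ v ⬝ᵥ (Y *ᵥ v)) :
    predictedMoment p μ γ Ah Bh d K x₀ φ l X ≤ predictedMoment p μ γ Ah Bh d K x₀ φ l Y :=
  integral_mono (integrable_predictedState hγ hp0 hp1 l X)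
    (integrable_predictedState hγ hp0 hp1 l Y) fun _ => h _

theorem predictedMoment_nonneg (l : ℕ) {X : Matrix (Fin n) (Fin n) ℝ}
    (h : ∀ v : Fin n → ℝ, 0 ≤ v ⬝ᵥ (X *ᵥ v)) :
    0 ≤ predictedMoment p μ γ Ah Bh d K x₀ φ l X :=
  integral_nonneg fun _ => h _

/-- Decomposition of the second moment into predicted part and prediction error: revealing γ_l, …,
γ_{l+d-1} one at a time adds orthogonal innovations. -/
theorem integral_closedLoop_sq (hγ : IsDropoutProcess p μ γ) (hp0 : 0 ≤ p) (hp1 : p ≤ 1) (l : ℕ) :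
    ∫ ω, ∑ i, (closedLoop μ γ Ah Bh d K x₀ φ (l + d) ω i) ^ 2 ∂μ =
      predictedMoment p μ γ Ah Bh d K x₀ φ l 1 + ∑ j ∈ Finset.range d, p * (1 - p) *
        ∫ ω, ((Ah ^ (d - 1 - j)) *ᵥ plantInput μ γ Ah Bh d K x₀ φ (l + j) ω) ⬝ᵥ
          ((1 : Matrix (Fin n) (Fin n) ℝ) *ᵥ
            ((Ah ^ (d - 1 - j)) *ᵥ plantInput μ γ Ah Bh d K x₀ φ (l + j) ω)) ∂μ := by
  set P := predictor Ah (1 - p) (closedLoop μ γ Ah Bh d K x₀ φ)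
    (plantInput μ γ Ah Bh d K x₀ φ) with hP
  -- `P (l + i) (d - i)` forecasts x_{l+d} from time l + i; it runs from the predicted state at i =
  -- 0 to the state itself at i = d.
  have key : ∀ i ≤ d, ∫ ω, P (l + i) (d - i) ω ⬝ᵥ
      ((1 : Matrix (Fin n) (Fin n) ℝ) *ᵥ P (l + i) (d - i) ω) ∂μ =
      predictedMoment p μ γ Ah Bh d K x₀ φ l 1 + ∑ j ∈ Finset.range i, p * (1 - p) *
        ∫ ω, ((Ah ^ (d - 1 - j)) *ᵥ plantInput μ γ Ah Bh d K x₀ φ (l + j) ω) ⬝ᵥ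
          ((1 : Matrix (Fin n) (Fin n) ℝ) *ᵥ
            ((Ah ^ (d - 1 - j)) *ᵥ plantInput μ γ Ah Bh d K x₀ φ (l + j) ω)) ∂μ := by
    intro i hi
    induction i with
    | zero => simp only [Finset.range_zero, Finset.sum_empty, add_zero]; rfl
    | succ i ih =>
      rw [Finset.sum_range_succ, ← add_assoc (predictedMoment p μ γ Ah Bh d K x₀ φ l 1),
        ← ih (by omega), show d - 1 - i = d - (i + 1) by omega,
        show d - i = d - (i + 1) + 1 by omega]
      exact integral_predictor_succ_left hγ hp0 hp1 1 (l + i) (d - (i + 1)) (by omega)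
  rw [← key d le_rfl, Nat.sub_self]
  simp only [one_mulVec, dotProduct, ← pow_two, hP, predictor]

theorem tendsto_closedLoop_iff (hγ : IsDropoutProcess p μ γ) (hp0 : 0 ≤ p) (hp1 : p ≤ 1) :
    Tendsto (fun k => ∫ ω, ∑ i, (closedLoop μ γ Ah Bh d K x₀ φ k ω i) ^ 2 ∂μ) atTop (𝓝 0) ↔
      Tendsto (fun l => predictedMoment p μ γ Ah Bh d K x₀ φ l 1) atTop (𝓝 0) := by
  have h1 : ∀ v : Fin n → ℝ, 0 ≤ v ⬝ᵥ ((1 : Matrix (Fin n) (Fin n) ℝ) *ᵥ v) := fun v => by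
    rw [one_mulVec]; exact Finset.sum_nonneg fun i _ => mul_self_nonneg _
  rw [← tendsto_add_atTop_iff_nat d]
  simp only [integral_closedLoop_sq hγ hp0 hp1]
  have hpq : 0 ≤ p * (1 - p) := mul_nonneg hp0 (by linarith)
  constructor
  · intro h
    refine squeeze_zero (fun l => predictedMoment_nonneg l h1) (fun l => ?_) h
    exact le_add_of_nonneg_right (Finset.sum_nonneg fun j _ =>
      mul_nonneg hpq (integral_nonneg fun _ => h1 _))
  · intro h
    have hX : ∀ X : Matrix (Fin n) (Fin n) ℝ,
        Tendsto (fun l => predictedMoment p μ γ Ah Bh d K x₀ φ l X) atTop (𝓝 0) := by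
      intro X
      obtain ⟨C, -, hC⟩ := exists_abs_quadratic_le X
      refine squeeze_zero_norm (fun l => ?_) (by simpa using h.const_mul C)
      rw [Real.norm_eq_abs, abs_le, ← predictedMoment_smul, ← neg_one_mul,
        ← predictedMoment_smul]
      refine ⟨predictedMoment_mono hγ hp0 hp1 l fun v => ?_,
        predictedMoment_mono hγ hp0 hp1 l fun v => ?_⟩ <;>
      · have := abs_le.1 (hC v)
        simp only [smul_mulVec, one_mulVec, dotProduct_smul, smul_eq_mul]
        linarith
    have hsum := tendsto_finsetSum (f := fun j l => p * (1 - p) *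
        ∫ ω, ((Ah ^ (d - 1 - j)) *ᵥ plantInput μ γ Ah Bh d K x₀ φ (l + j) ω) ⬝ᵥ
          ((1 : Matrix (Fin n) (Fin n) ℝ) *ᵥ
            ((Ah ^ (d - 1 - j)) *ᵥ plantInput μ γ Ah Bh d K x₀ φ (l + j) ω)) ∂μ)
      (a := fun _ => 0) (Finset.range d) (x := atTop) fun j _ => ?_
    · simpa using h.add hsum
    -- After a shift by d the input is feedback rather than initial data, so each error term is a
    -- moment of an earlier predicted state.
    rw [← tendsto_add_atTop_iff_nat d]
    have : ∀ l, l + d + j = l + j + d := fun l => by omega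
    simp only [this, integral_plantInput hγ hp0 hp1]
    have h2 := ((tendsto_add_atTop_iff_nat j).2 (hX ((Ah ^ (d - 1 - j) * (Bh * K))ᵀ * 1 *
      (Ah ^ (d - 1 - j) * (Bh * K))))).const_mul (p * (1 - p))
    rwa [mul_zero] at h2

end ClosedLoop

/-! ### Delayed linear recursions -/

section DelayedPower

variable {R : Type*} [Ring R]

/-- The coefficients of the power series `(1 - a z - b z ^ (d + 1))⁻¹`. -/
def delayedPower (a b : R) (d : ℕ) : ℕ → R
  | 0 => 1
  | k + 1 => delayedPower a b d k * a + if d ≤ k then delayedPower a b d (k - d) * b else 0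

theorem delayedPower_zero (a b : R) (d : ℕ) : delayedPower a b d 0 = 1 := by
  rw [delayedPower]

theorem delayedPower_succ (a b : R) (d k : ℕ) : delayedPower a b d (k + 1) =
    delayedPower a b d k * a + if d ≤ k then delayedPower a b d (k - d) * b else 0 := by
  rw [delayedPower]

/-- The inverse of a power series is two-sided, so a and b may also multiply from the left. The
right-hand form matches the moment recursion; this one preserves positivity and can be summed. -/
theorem delayedPower_succ' (a b : R) (d k : ℕ) : delayedPower a b d (k + 1) =
    a * delayedPower a b d k + if d ≤ k then b * delayedPower a b d (k - d) else 0 := by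
  induction k using Nat.strong_induction_on with
  | _ k ih =>
    rcases k with _ | k
    · rw [delayedPower_succ]
      by_cases h : d ≤ 0 <;> simp [h, delayedPower_zero]
    rw [delayedPower_succ]
    conv_lhs => rw [ih k k.lt_succ_self]
    conv_rhs => rw [delayedPower_succ a b d k]
    by_cases h : d ≤ k
    · have h' : d ≤ k + 1 := by omega
      obtain ⟨j, rfl⟩ : ∃ j, k = j + d := ⟨k - d, by omega⟩
      simp only [h, h', if_true, show j + d + 1 - d = j + 1 by omega, Nat.add_sub_cancel]
      conv_rhs => rw [delayedPower_succ a b d j]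
      rw [ih j (by omega)]
      by_cases h2 : d ≤ j <;> simp only [h2, if_true, if_false] <;> noncomm_ring
    · by_cases h' : d ≤ k + 1
      · have : k + 1 - d = 0 := by omega
        simp [h, h', this, delayedPower_zero, mul_assoc]
      · simp [h, h', mul_assoc]

theorem sum_delayedPower_succ (a b : R) (d N : ℕ) :
    ∑ k ∈ Finset.range (N + d), delayedPower a b d (k + 1) =
      a * ∑ k ∈ Finset.range (N + d), delayedPower a b d k +
        b * ∑ k ∈ Finset.range N, delayedPower a b d k := by
  induction N with
  | zero =>
    rw [Finset.sum_range_zero, mul_zero, add_zero, Finset.mul_sum]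
    refine Finset.sum_congr rfl fun k hk => ?_
    have : ¬ d ≤ k := by have := Finset.mem_range.1 hk; omega
    rw [delayedPower_succ', if_neg this, add_zero]
  | succ N ih =>
    rw [show N + 1 + d = N + d + 1 by omega, Finset.sum_range_succ, ih, delayedPower_succ',
      if_pos (by omega), Nat.add_sub_cancel, Finset.sum_range_succ _ (N + d),
      Finset.sum_range_succ _ N]
    noncomm_ring

/-- The partial sums of the delayed powers invert `1 - a - b` up to a tail. -/
theorem sum_delayedPower_sub (a b : R) (d N : ℕ) :
    (1 - a - b) * ∑ k ∈ Finset.range (N + d), delayedPower a b d k =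
      1 - delayedPower a b d (N + d) - b * ∑ j ∈ Finset.range d, delayedPower a b d (N + j) := by
  have h1 := sum_delayedPower_succ a b d N
  have h2 := Finset.sum_range_succ (delayedPower a b d) (N + d)
  rw [Finset.sum_range_succ', delayedPower_zero] at h2
  have h3 := Finset.sum_range_add (delayedPower a b d) N d
  rw [h1, add_assoc, add_comm] at h2
  have h4 : ∑ k ∈ Finset.range (N + d), delayedPower a b d k =
      a * ∑ k ∈ Finset.range (N + d), delayedPower a b d k +
        (b * ∑ k ∈ Finset.range N, delayedPower a b d k + 1) - delayedPower a b d (N + d) := by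
    rw [eq_sub_iff_add_eq, ← h2]; abel
  rw [sub_mul, sub_mul, one_mul]
  conv_lhs => enter [1, 1]; rw [h4]
  rw [h3]
  noncomm_ring

end DelayedPower

/-! ### Uniform positivity -/

section Positivity

variable {n : ℕ}

/-- A continuous family of forms which are positive on a compact set is uniformly positive. -/
theorem exists_uniform_lower_bound {T : Set ℝ} (hT : IsCompact T)
    {M : ℝ → Matrix (Fin n) (Fin n) ℝ} (hM : ContinuousOn M T)
    (hpos : ∀ t ∈ T, ∀ v : Fin n → ℝ, v ≠ 0 → 0 < v ⬝ᵥ (M t *ᵥ v)) :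
    ∃ c : ℝ, 0 < c ∧ ∀ t ∈ T, ∀ v : Fin n → ℝ, c * (v ⬝ᵥ v) ≤ v ⬝ᵥ (M t *ᵥ v) := by
  have hS : IsCompact {v : Fin n → ℝ | v ⬝ᵥ v = 1} := by
    refine Metric.isCompact_of_isClosed_isBounded
      (isClosed_eq (by unfold dotProduct; fun_prop) continuous_const)
      ((Metric.isBounded_closedBall (x := (0 : Fin n → ℝ)) (r := 1)).subset fun v hv => ?_)
    rw [mem_closedBall_zero_iff, pi_norm_le_iff_of_nonneg zero_le_one]
    intro i
    have hv : v ⬝ᵥ v = 1 := hv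
    have h1 := Finset.single_le_sum (f := fun i => v i * v i)
      (fun i _ => mul_self_nonneg _) (Finset.mem_univ i)
    rw [Real.norm_eq_abs]
    refine abs_le_one_iff_mul_self_le_one.2 (h1.trans hv.le)
  have hcont : ContinuousOn (fun z : ℝ × (Fin n → ℝ) => z.2 ⬝ᵥ (M z.1 *ᵥ z.2))
      (T ×ˢ {v | v ⬝ᵥ v = 1}) := by
    have hM' : ContinuousOn (fun z : ℝ × (Fin n → ℝ) => M z.1) (T ×ˢ {v | v ⬝ᵥ v = 1}) :=
      hM.comp continuousOn_fst fun z hz => hz.1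
    have hMij : ∀ i j, ContinuousOn (fun z : ℝ × (Fin n → ℝ) => M z.1 i j)
        (T ×ˢ {v | v ⬝ᵥ v = 1}) := fun i j =>
      continuousOn_pi.1 (continuousOn_pi.1 hM' i) j
    have hv : ∀ i, ContinuousOn (fun z : ℝ × (Fin n → ℝ) => z.2 i) (T ×ˢ {v | v ⬝ᵥ v = 1}) :=
      fun i => ((continuous_apply i).comp continuous_snd).continuousOn
    simp only [dotProduct, mulVec]
    exact continuousOn_finsetSum _ fun i _ => (hv i).fun_mul
      (continuousOn_finsetSum _ fun j _ => (hMij i j).fun_mul (hv j))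
  obtain ⟨c, hc, h⟩ := (hT.prod hS).exists_forall_le' hcont (a := 0) fun z hz => by
    refine hpos z.1 hz.1 z.2 fun h0 => ?_
    have h2 : z.2 ⬝ᵥ z.2 = 1 := hz.2
    rw [h0, dotProduct_zero] at h2
    exact zero_ne_one h2
  refine ⟨c, hc, fun t ht v => ?_⟩
  by_cases hv : v = 0
  · simp [hv]
  have hvv : 0 < v ⬝ᵥ v := by
    have := dotProduct_star_self_pos_iff.2 hv
    simpa using this
  set r := Real.sqrt (v ⬝ᵥ v) with hr
  have hrr : r * r = v ⬝ᵥ v := Real.mul_self_sqrt hvv.le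
  have hr0 : 0 < r := Real.sqrt_pos.2 hvv
  have hw := h (t, r⁻¹ • v) ⟨ht, by
    show (r⁻¹ • v) ⬝ᵥ (r⁻¹ • v) = 1
    rw [smul_dotProduct, dotProduct_smul, ← hrr, smul_eq_mul, smul_eq_mul]
    field_simp⟩
  simp only [mulVec_smul, smul_dotProduct, dotProduct_smul, smul_eq_mul] at hw
  rw [← hrr]
  calc c * (r * r) ≤ (r⁻¹ * (r⁻¹ * (v ⬝ᵥ (M t *ᵥ v)))) * (r * r) :=
        mul_le_mul_of_nonneg_right hw (by positivity)
    _ = v ⬝ᵥ (M t *ᵥ v) := by field_simp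

theorem exists_lower_bound {X : Matrix (Fin n) (Fin n) ℝ}
    (hX : ∀ v : Fin n → ℝ, v ≠ 0 → 0 < v ⬝ᵥ (X *ᵥ v)) :
    ∃ c : ℝ, 0 < c ∧ ∀ v : Fin n → ℝ, c * (v ⬝ᵥ v) ≤ v ⬝ᵥ (X *ᵥ v) := by
  obtain ⟨c, hc, h⟩ := exists_uniform_lower_bound (isCompact_singleton (x := (0 : ℝ)))
    (M := fun _ => X) continuousOn_const fun _ _ => hX
  exact ⟨c, hc, h 0 rfl⟩

theorem Matrix.PosDef.quadratic_pos {X : Matrix (Fin n) (Fin n) ℝ} (hX : X.PosDef)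
    (v : Fin n → ℝ) (hv : v ≠ 0) : 0 < v ⬝ᵥ (X *ᵥ v) := by
  simpa using hX.dotProduct_mulVec_pos hv

theorem Matrix.PosSemidef.quadratic_nonneg {X : Matrix (Fin n) (Fin n) ℝ} (hX : X.PosSemidef)
    (v : Fin n → ℝ) : 0 ≤ v ⬝ᵥ (X *ᵥ v) := by
  simpa using hX.dotProduct_mulVec_nonneg v

theorem posDef_of_isSymm {X : Matrix (Fin n) (Fin n) ℝ} (hX : X.IsSymm)
    (h : ∀ v : Fin n → ℝ, v ≠ 0 → 0 < v ⬝ᵥ (X *ᵥ v)) : X.PosDef :=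
  PosDef.of_dotProduct_mulVec_pos (by rwa [IsHermitian, conjTranspose_eq_transpose_of_trivial])
    fun v hv => by simpa using h v hv

theorem posSemidef_of_isSymm {X : Matrix (Fin n) (Fin n) ℝ} (hX : X.IsSymm)
    (h : ∀ v : Fin n → ℝ, 0 ≤ v ⬝ᵥ (X *ᵥ v)) : X.PosSemidef :=
  PosSemidef.of_dotProduct_mulVec_nonneg
    (by rwa [IsHermitian, conjTranspose_eq_transpose_of_trivial]) fun v => by simpa using h v

theorem isSymm_of_isHermitian {X : Matrix (Fin n) (Fin n) ℝ} (hX : X.IsHermitian) : X.IsSymm := by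
  rwa [IsHermitian, conjTranspose_eq_transpose_of_trivial] at hX

/-- A sequence of symmetric matrices whose forms tend to zero tends to zero. -/
theorem tendsto_entry_of_tendsto_quadratic {Y : ℕ → Matrix (Fin n) (Fin n) ℝ}
    (hY : ∀ k, (Y k).IsSymm)
    (h : ∀ v : Fin n → ℝ, Tendsto (fun k => v ⬝ᵥ (Y k *ᵥ v)) atTop (𝓝 0)) (i j : Fin n) :
    Tendsto (fun k => Y k i j) atTop (𝓝 0) := by
  -- Polarization.
  have key : ∀ k, Y k i j = ((Pi.single i 1 + Pi.single j 1) ⬝ᵥ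
      (Y k *ᵥ (Pi.single i 1 + Pi.single j 1)) - Pi.single i 1 ⬝ᵥ (Y k *ᵥ Pi.single i 1) -
      Pi.single j 1 ⬝ᵥ (Y k *ᵥ Pi.single j 1)) * 2⁻¹ := by
    intro k
    have := (hY k).apply i j
    simp [mulVec_add, add_dotProduct, dotProduct_add]
    rw [this]
    ring
  simp only [key]
  have := (((h (Pi.single i 1 + Pi.single j 1)).sub (h (Pi.single i 1))).sub
    (h (Pi.single j 1))).mul_const (2⁻¹ : ℝ)
  rwa [sub_zero, sub_zero, zero_mul] at this

end Positivity

/-! ### Stability for a fixed dropout rate -/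

section FixedRate

variable {n m : ℕ}

/-- The congruence `X ↦ Mᵀ X M` as a linear map. -/
def congruence (M : Matrix (Fin n) (Fin n) ℝ) : Module.End ℝ (Matrix (Fin n) (Fin n) ℝ) where
  toFun X := Mᵀ * X * M
  map_add' X Y := by rw [mul_add, add_mul]
  map_smul' c X := by simp

theorem congruence_apply (M X : Matrix (Fin n) (Fin n) ℝ) : congruence M X = Mᵀ * X * M := rfl

theorem posSemidef_congruence {X : Matrix (Fin n) (Fin n) ℝ} (hX : X.PosSemidef)
    (M : Matrix (Fin n) (Fin n) ℝ) : (congruence M X).PosSemidef := by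
  have := hX.conjTranspose_mul_mul_same M
  rwa [conjTranspose_eq_transpose_of_trivial] at this

variable (Ah : Matrix (Fin n) (Fin n) ℝ) (Bh : Matrix (Fin n) (Fin m) ℝ) (d : ℕ)
  (K : Matrix (Fin m) (Fin n) ℝ) (p : ℝ)

theorem lyapunovL_eq (X : Matrix (Fin n) (Fin n) ℝ) :
    lyapunovL Ah Bh d K p X = X - congruence (Ah + (1 - p) • (Bh * K)) X -
      ((p * (1 - p)) • congruence (Ah ^ d * (Bh * K))) X := by
  simp only [lyapunovL, congruence_apply, LinearMap.smul_apply, transpose_mul, transpose_pow,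
    Matrix.mul_assoc]

theorem isSymm_lyapunovL {X : Matrix (Fin n) (Fin n) ℝ} (hX : X.IsSymm) :
    (lyapunovL Ah Bh d K p X).IsSymm := by
  rw [lyapunovL_eq]
  simp only [IsSymm, congruence_apply, LinearMap.smul_apply, transpose_sub, transpose_smul,
    transpose_mul, transpose_transpose, hX.eq, Matrix.mul_assoc]

variable {Ah Bh d K p}

variable {Ω : Type*} [MeasurableSpace Ω] {μ : Measure Ω} [IsProbabilityMeasure μ]
  {γ : ℕ → Ω → ℝ}

/-- The delay is absorbed in the functional V_l = E z_{l+d}'Xz_{l+d} + Σ_{j<d} E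
z_{l+j}'b(X)z_{l+j}, whose decrease in one step is exactly E z_{l+d}'L_K(p,X)z_{l+d}. The total
decrease is at most V_0, so the second moments are summable. -/
theorem isStabilizedBy_of_lyapunov (hγ : IsDropoutProcess p μ γ) (hp0 : 0 ≤ p) (hp1 : p ≤ 1)
    {X : Matrix (Fin n) (Fin n) ℝ} (hX : X.PosSemidef)
    (hL : ∀ v : Fin n → ℝ, v ≠ 0 → 0 < v ⬝ᵥ (lyapunovL Ah Bh d K p X *ᵥ v)) :
    IsStabilizedBy μ γ Ah Bh d K := by
  intro x₀ φ
  rw [tendsto_closedLoop_iff hγ hp0 hp1, ← tendsto_add_atTop_iff_nat d]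
  set f := predictedMoment p μ γ Ah Bh d K x₀ φ with hf
  set F := Ah + (1 - p) • (Bh * K)
  set T := (p * (1 - p)) • congruence (Ah ^ d * (Bh * K)) with hT
  have hpq : 0 ≤ p * (1 - p) := mul_nonneg hp0 (by linarith)
  obtain ⟨c, hc, hcL⟩ := exists_lower_bound hL
  have hTX : ∀ v : Fin n → ℝ, 0 ≤ v ⬝ᵥ (T X *ᵥ v) :=
    ((posSemidef_congruence hX _).smul hpq).quadratic_nonneg
  have hstep : ∀ l, f (l + d + 1) X + ∑ j ∈ Finset.range d, f (l + 1 + j) (T X) +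
      c * f (l + d) 1 ≤ f (l + d) X + ∑ j ∈ Finset.range d, f (l + j) (T X) := by
    intro l
    have h1 : f (l + d + 1) X = f (l + d) (congruence F X) + f l (T X) := by
      rw [hf, predictedMoment_succ hγ hp0 hp1, hT, LinearMap.smul_apply, predictedMoment_smul]
      rfl
    have h2 := Finset.sum_range_succ (fun j => f (l + j) (T X)) d
    rw [Finset.sum_range_succ'] at h2
    have h3 : f (l + d) X = f (l + d) (congruence F X) + f (l + d) (T X) +
        f (l + d) (lyapunovL Ah Bh d K p X) := by
      rw [← predictedMoment_add hγ hp0 hp1, ← predictedMoment_add hγ hp0 hp1, lyapunovL_eq]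
      congr 1
      abel
    have h4 : c * f (l + d) 1 ≤ f (l + d) (lyapunovL Ah Bh d K p X) := by
      rw [hf, ← predictedMoment_smul]
      refine predictedMoment_mono hγ hp0 hp1 _ fun v => ?_
      rw [smul_mulVec, one_mulVec, dotProduct_smul]
      exact hcL v
    have h5 : ∑ j ∈ Finset.range d, f (l + (j + 1)) (T X) =
        ∑ j ∈ Finset.range d, f (l + 1 + j) (T X) :=
      Finset.sum_congr rfl fun j _ => by rw [show l + (j + 1) = l + 1 + j by omega]
    have h6 : f (l + 0) (T X) = f l (T X) := rfl
    rw [h5, h6] at h2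
    linarith
  have hnn : ∀ l, 0 ≤ f l 1 := fun l => predictedMoment_nonneg l PosSemidef.one.quadratic_nonneg
  have hbound : ∀ N, ∑ l ∈ Finset.range N, c * f (l + d) 1 + (f (N + d) X +
      ∑ j ∈ Finset.range d, f (N + j) (T X)) ≤ f d X + ∑ j ∈ Finset.range d, f j (T X) := by
    intro N
    induction N with
    | zero => simp only [Finset.sum_range_zero, zero_add]; exact le_rfl
    | succ N ih =>
      rw [Finset.sum_range_succ, show N + 1 + d = N + d + 1 by omega]
      linarith [hstep N]
  have hsum : Summable fun l => c * f (l + d) 1 := by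
    refine summable_of_sum_range_le (c := f d X + ∑ j ∈ Finset.range d, f j (T X))
      (fun l => mul_nonneg hc.le (hnn _)) fun N => ?_
    have h6 : 0 ≤ f (N + d) X := predictedMoment_nonneg _ hX.quadratic_nonneg
    have h7 : 0 ≤ ∑ j ∈ Finset.range d, f (N + j) (T X) :=
      Finset.sum_nonneg fun j _ => predictedMoment_nonneg _ hTX
    linarith [hbound N]
  have := hsum.tendsto_atTop_zero.const_mul c⁻¹
  simpa [← mul_assoc, inv_mul_cancel₀ hc.ne'] using this

theorem exists_lyapunov_of_isStabilizedBy (hγ : IsDropoutProcess p μ γ) (hp0 : 0 ≤ p)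
    (hp1 : p ≤ 1) (hA : IsUnit Ah) (hK : IsStabilizedBy μ γ Ah Bh d K) :
    ∃ X : Matrix (Fin n) (Fin n) ℝ, X.PosDef ∧ (lyapunovL Ah Bh d K p X).PosDef := by
  set a := congruence (Ah + (1 - p) • (Bh * K)) with ha
  set b := (p * (1 - p)) • congruence (Ah ^ d * (Bh * K)) with hb
  set S := delayedPower a b d with hS
  have hpq : 0 ≤ p * (1 - p) := mul_nonneg hp0 (by linarith)
  have hpsd : ∀ k, (S k 1).PosSemidef := by
    intro k
    induction k using Nat.strong_induction_on with
    | _ k ih =>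
      rcases k with _ | k
      · rw [hS, delayedPower_zero]
        exact PosSemidef.one
      · rw [hS, delayedPower_succ', LinearMap.add_apply]
        refine (posSemidef_congruence (ih k k.lt_succ_self) _).add ?_
        by_cases h : d ≤ k
        · rw [if_pos h]
          exact (posSemidef_congruence (ih (k - d) (by omega)) _).smul hpq
        · rw [if_neg h]
          exact PosSemidef.zero
  -- With zero initial inputs the moment recursion starts from A_h^d x₀ alone, so `delayedPower`
  -- solves it.
  have hmom : ∀ (x₀ : Fin n → ℝ) (k : ℕ) (X : Matrix (Fin n) (Fin n) ℝ),
      predictedMoment p μ γ Ah Bh d K x₀ 0 k X =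
        ((Ah ^ d) *ᵥ x₀) ⬝ᵥ (S k X *ᵥ ((Ah ^ d) *ᵥ x₀)) := by
    intro x₀ k
    induction k using Nat.strong_induction_on with
    | _ k ih =>
      intro X
      rcases k with _ | k
      · rw [predictedMoment_zero, hS, delayedPower_zero]
        rfl
      · rw [hS, delayedPower_succ, LinearMap.add_apply, add_mulVec, dotProduct_add]
        by_cases h : d ≤ k
        · obtain ⟨l, rfl⟩ : ∃ l, k = l + d := ⟨k - d, by omega⟩
          rw [if_pos h, predictedMoment_succ hγ hp0 hp1, ih _ (by omega), ih _ (by omega),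
            Nat.add_sub_cancel, Module.End.mul_apply, Module.End.mul_apply, hb,
            LinearMap.smul_apply, map_smul, smul_mulVec, dotProduct_smul]
          rfl
        · rw [if_neg h, predictedMoment_succ_of_lt hγ hp0 hp1 X (by omega), ih _ (by omega)]
          simp only [LinearMap.zero_apply, zero_mulVec, dotProduct_zero, add_zero]
          rfl
  have hquad : ∀ v : Fin n → ℝ, Tendsto (fun k => v ⬝ᵥ (S k 1 *ᵥ v)) atTop (𝓝 0) := by
    intro v
    -- Invertibility makes every vector v a possible initial prediction A_h^d x₀.
    have hu : IsUnit (Ah ^ d) := hA.pow d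
    obtain ⟨x₀, rfl⟩ := (mulVec_surjective_iff_isUnit.2 hu) v
    simp only [← hmom]
    exact (tendsto_closedLoop_iff hγ hp0 hp1).1 (hK x₀ 0)
  have hentry := tendsto_entry_of_tendsto_quadratic
    (fun k => isSymm_of_isHermitian (hpsd k).isHermitian) hquad
  have hSlim : Tendsto (fun k => S k 1) atTop (𝓝 0) :=
    tendsto_pi_nhds.2 fun i => tendsto_pi_nhds.2 fun j => hentry i j
  set E : ℕ → Matrix (Fin n) (Fin n) ℝ := fun N =>
    S (N + d) 1 + b (∑ j ∈ Finset.range d, S (N + j) 1) with hE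
  have hElim : Tendsto E atTop (𝓝 0) := by
    have h1 : Tendsto (fun N => ∑ j ∈ Finset.range d, S (N + j) 1) atTop (𝓝 0) := by
      have := tendsto_finsetSum (f := fun j N => S (N + j) 1) (a := fun _ => 0) (x := atTop)
        (Finset.range d) fun j _ => (tendsto_add_atTop_iff_nat j).2 hSlim
      simpa using this
    have hbc : Continuous b := b.continuous_of_finiteDimensional
    have h2 := (hbc.tendsto 0).comp h1
    rw [map_zero] at h2
    have := ((tendsto_add_atTop_iff_nat d).2 hSlim).add h2
    rwa [add_zero] at this
  -- Entries of this size bound the form of the tail by n/(2(n+1)) < 1 times |v|². A finite partial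
  -- sum is enough, so summability of the series is not needed.
  have hsmall : ∀ᶠ N in atTop, ∀ i j, |E N i j| ≤ 1 / (2 * (n + 1)) := by
    refine eventually_all.2 fun i => eventually_all.2 fun j => ?_
    have h1 := (tendsto_pi_nhds.1 (tendsto_pi_nhds.1 hElim i) j).abs
    simp only [Matrix.zero_apply, abs_zero] at h1
    exact h1.eventually_le_const (by positivity)
  -- N ≥ 1 ensures that the sum contains its term I at k = 0, hence is positive definite.
  obtain ⟨N, hN, hN1⟩ := (hsmall.and (eventually_ge_atTop 1)).exists
  set W := ∑ k ∈ Finset.range (N + d), S k 1 with hW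
  have hWpos : W.PosDef := by
    obtain ⟨M, hM⟩ : ∃ M, N + d = M + 1 := ⟨N + d - 1, by omega⟩
    rw [hW, hM, Finset.sum_range_succ', add_comm, hS, delayedPower_zero]
    exact PosDef.one.add_posSemidef (posSemidef_sum _ fun k _ => hpsd _)
  have hLW : lyapunovL Ah Bh d K p W = 1 - E N := by
    have h1 := congrArg (fun f : Module.End ℝ (Matrix (Fin n) (Fin n) ℝ) => f 1)
      (sum_delayedPower_sub a b d N)
    simp only [Module.End.mul_apply, LinearMap.sub_apply, Module.End.one_apply,
      LinearMap.sum_apply] at h1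
    rw [lyapunovL_eq, hE]
    simp only
    rw [← sub_sub]
    exact h1
  refine ⟨W, hWpos, posDef_of_isSymm
    (isSymm_lyapunovL _ _ _ _ _ (isSymm_of_isHermitian hWpos.isHermitian)) fun v hv => ?_⟩
  have hvv : 0 < v ⬝ᵥ v := by
    have := dotProduct_star_self_pos_iff.2 hv
    simpa using this
  have h2 := (abs_le.1 (abs_quadratic_le hN v)).2
  rw [hLW, sub_mulVec, one_mulVec, dotProduct_sub]
  have h3 : n * (1 / (2 * ((n : ℝ) + 1))) < 1 := by
    rw [mul_one_div, div_lt_one (by positivity)]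
    linarith [(Nat.cast_nonneg n : (0 : ℝ) ≤ n)]
  nlinarith

end FixedRate

/-! ### Sums of squares from positivity on the unit interval -/

section SumOfSquares

/-- The ratio C(N-i-1,k)/C(N-i,k) is (N-i-k)/(N-i), which differs from (N-k)/N by ki/(N(N-i)) ≤
i/(N-i). -/
theorem abs_choose_succ_sub_le {N i k : ℕ} (hk : k ≤ N) (hi : i < N) :
    |((N - (i + 1)).choose k : ℝ) - ((N : ℝ) - k) / N * (N - i).choose k| ≤
      i / ((N : ℝ) - i) * N.choose k := by
  have hN : (0 : ℝ) < N := by exact_mod_cast (show 0 < N by omega)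
  have hNi : (0 : ℝ) < (N : ℝ) - i := by
    have : (i : ℝ) < N := by exact_mod_cast hi
    linarith
  have hkN : (k : ℝ) ≤ N := by exact_mod_cast hk
  have hrec : ((N - (i + 1)).choose k : ℝ) * (N - i) = (N - i).choose k * ((N : ℝ) - i - k) := by
    have h := Nat.choose_mul_succ_eq (N - (i + 1)) k
    rw [show N - (i + 1) + 1 = N - i by omega] at h
    by_cases hc : k ≤ N - i
    · have h' := congrArg (Nat.cast (R := ℝ)) h
      push_cast [Nat.cast_sub hc, Nat.cast_sub (show i + 1 ≤ N by omega),
        Nat.cast_sub hi.le] at h'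
      linear_combination h'
    · rw [Nat.choose_eq_zero_of_lt (by omega : N - i < k),
        Nat.choose_eq_zero_of_lt (by omega : N - (i + 1) < k)]
      simp
  have hle : ((N - i).choose k : ℝ) ≤ N.choose k := by
    exact_mod_cast Nat.choose_le_choose k (Nat.sub_le N i)
  have e1 : ((N - (i + 1)).choose k : ℝ) = (N - i).choose k * ((N : ℝ) - i - k) / (N - i) := by
    rw [← hrec]; field_simp
  have e2 : ((N - (i + 1)).choose k : ℝ) - ((N : ℝ) - k) / N * (N - i).choose k =
      -((k / N) * (i / ((N : ℝ) - i)) * (N - i).choose k) := by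
    rw [e1]; field_simp; ring
  rw [e2, abs_neg, abs_of_nonneg (by positivity)]
  have h1 : (k : ℝ) / N ≤ 1 := (div_le_one hN).2 hkN
  calc (k : ℝ) / N * (i / ((N : ℝ) - i)) * (N - i).choose k
      ≤ 1 * (i / ((N : ℝ) - i)) * N.choose k := by gcongr
    _ = _ := by rw [one_mul]

/-- The binomial ratios `C(N - i, k) / C(N, k)` approach `((N - k) / N) ^ i` uniformly in `k`. -/
theorem eventually_abs_choose_sub_le (i : ℕ) {ε : ℝ} (hε : 0 < ε) :
    ∀ᶠ N : ℕ in atTop, ∀ k ≤ N, |((N - i).choose k : ℝ) - (((N : ℝ) - k) / N) ^ i * N.choose k| ≤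
      ε * N.choose k := by
  induction i generalizing ε with
  | zero =>
    refine Eventually.of_forall fun N k _ => ?_
    simp only [Nat.sub_zero, pow_zero, one_mul, sub_self, abs_zero]
    positivity
  | succ i ih =>
    have hlim : Tendsto (fun N : ℕ => (i : ℝ) / ((N : ℝ) - i)) atTop (𝓝 0) :=
      tendsto_const_nhds.div_atTop
        (tendsto_atTop_add_const_right _ (-(i : ℝ)) tendsto_natCast_atTop_atTop)
    filter_upwards [ih (half_pos hε), hlim.eventually_le_const (half_pos hε),
      eventually_gt_atTop i] with N h1 h2 h3 k hk
    have hN : (0 : ℝ) < N := by exact_mod_cast (show 0 < N by omega)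
    have hkN : (k : ℝ) ≤ N := by exact_mod_cast hk
    set t := ((N : ℝ) - k) / N with ht
    have ht0 : 0 ≤ t := div_nonneg (by linarith) hN.le
    have ht1 : t ≤ 1 := (div_le_one hN).2 (by linarith [(Nat.cast_nonneg k : (0 : ℝ) ≤ k)])
    have hc : (0 : ℝ) ≤ N.choose k := Nat.cast_nonneg _
    calc |((N - (i + 1)).choose k : ℝ) - t ^ (i + 1) * N.choose k|
        = |(((N - (i + 1)).choose k : ℝ) - t * (N - i).choose k) +
            t * ((N - i).choose k - t ^ i * N.choose k)| := by congr 1; ring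
      _ ≤ |((N - (i + 1)).choose k : ℝ) - t * (N - i).choose k| +
            t * |((N - i).choose k : ℝ) - t ^ i * N.choose k| := by
          refine (abs_add_le _ _).trans_eq ?_
          rw [abs_mul, abs_of_nonneg ht0]
      _ ≤ ε / 2 * N.choose k + 1 * (ε / 2 * N.choose k) := by
          refine add_le_add ((abs_choose_succ_sub_le hk h3).trans ?_)
            (mul_le_mul ht1 (h1 k hk) (abs_nonneg _) zero_le_one)
          exact mul_le_mul_of_nonneg_right h2 hc
      _ = ε * N.choose k := by ring

variable {n : ℕ}

theorem evalMat_apply (P : Matrix (Fin n) (Fin n) ℝ[X]) (x : ℝ) (i j : Fin n) :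
    evalMat P x i j = (P i j).eval x := rfl

theorem matDegree_le_iff (P : Matrix (Fin n) (Fin n) ℝ[X]) (N : ℕ) :
    matDegree P ≤ N ↔ ∀ i j, (P i j).natDegree ≤ N := by
  simp [matDegree, Finset.sup_le_iff]

theorem evalMat_eq_sum {P : Matrix (Fin n) (Fin n) ℝ[X]} {M : ℕ} (hM : matDegree P < M) (x : ℝ) :
    evalMat P x = ∑ i ∈ Finset.range M, x ^ i • P.map (fun q => q.coeff i) := by
  ext a b
  have h := (matDegree_le_iff P _).1 le_rfl a b
  rw [evalMat_apply, Polynomial.eval_eq_sum_range' (h.trans_lt hM), Matrix.sum_apply]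
  exact Finset.sum_congr rfl fun i _ => by simp [mul_comm]

theorem exists_transpose_mul_self_eq {X : Matrix (Fin n) (Fin n) ℝ} (hX : X.PosSemidef) :
    ∃ B : Matrix (Fin n) (Fin n) ℝ, X = Bᵀ * B := by
  open scoped MatrixOrder in
  obtain ⟨B, hB⟩ := CStarAlgebra.nonneg_iff_eq_star_mul_self.1 hX.nonneg
  exact ⟨B, by rw [hB, star_eq_conjTranspose, conjTranspose_eq_transpose_of_trivial]⟩

/-- With E_k = B'B one has ξ^{2k}E_k = (ξ^k B)'(ξ^k B). -/
theorem isSOS_sum_pow_smul {N : ℕ} {E : ℕ → Matrix (Fin n) (Fin n) ℝ}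
    (hE : ∀ k ≤ N, (E k).PosSemidef) :
    IsSOS fun ξ => ∑ k ∈ Finset.range (N + 1), (ξ ^ 2) ^ k • E k := by
  have : ∀ k : Fin (N + 1), ∃ B : Matrix (Fin n) (Fin n) ℝ, E k = Bᵀ * B := fun k =>
    exists_transpose_mul_self_eq (hE k (by omega))
  choose B hB using this
  refine ⟨N + 1, fun k => (B k).map fun b => Polynomial.C b * Polynomial.X ^ (k : ℕ),
    fun ξ => ?_⟩
  refine (Finset.sum_range _).trans (Finset.sum_congr rfl fun k _ => ?_)
  have : evalMat ((B k).map fun b => Polynomial.C b * Polynomial.X ^ (k : ℕ)) ξ =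
      ξ ^ (k : ℕ) • B k := by
    ext a b
    rw [evalMat_apply, Matrix.map_apply, Polynomial.eval_mul, Polynomial.eval_C,
      Polynomial.eval_pow, Polynomial.eval_X, Matrix.smul_apply, smul_eq_mul, mul_comm]
  rw [this, hB, transpose_smul, smul_mul_smul_comm, ← pow_add, ← pow_mul, two_mul]

/-- A symmetric matrix polynomial which is positive definite on the unit interval has positive
semidefinite Bernstein coefficients of every sufficiently high degree. -/
theorem eventually_isSOS_of_pos {Q : Matrix (Fin n) (Fin n) ℝ[X]} (hQ : Q.IsSymm)
    (hpos : ∀ t ∈ Set.Icc (0 : ℝ) 1, ∀ v : Fin n → ℝ, v ≠ 0 → 0 < v ⬝ᵥ (evalMat Q t *ᵥ v)) :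
    ∀ᶠ N : ℕ in atTop, IsSOS fun ξ => (ξ ^ 2 + 1) ^ N • evalMat Q (ξ ^ 2 + 1)⁻¹ := by
  have hcont : ContinuousOn (fun t => evalMat Q t) (Set.Icc 0 1) :=
    continuousOn_pi.2 fun a => continuousOn_pi.2 fun b => (Q a b).continuous.continuousOn
  obtain ⟨c, hc, hlow⟩ := exists_uniform_lower_bound isCompact_Icc hcont hpos
  set M := matDegree Q + 1 with hM
  set C : ℕ → Matrix (Fin n) (Fin n) ℝ := fun i => Q.map fun q => q.coeff i with hC
  have heval : ∀ t, evalMat Q t = ∑ i ∈ Finset.range M, t ^ i • C i := fun t =>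
    evalMat_eq_sum (Nat.lt_succ_self _) t
  have hCsymm : ∀ i, (C i).IsSymm := fun i => by
    ext a b
    simp [hC, hQ.apply a b]
  choose D hD0 hD using fun i => exists_abs_quadratic_le (C i)
  set S := ∑ i ∈ Finset.range M, D i with hS
  have hS0 : 0 ≤ S := Finset.sum_nonneg fun i _ => hD0 i
  -- Replacing C(N-i,k) by t^i C(N,k) costs at most εS·C(N,k)|v|², which must not exceed the margin
  -- c·C(N,k)|v|².
  set ε := c / (S + 1) with hε
  have hε0 : 0 < ε := by positivity
  have hev := (Finset.eventually_all (Finset.range M)).2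
    fun i _ => eventually_abs_choose_sub_le i hε0
  filter_upwards [hev, eventually_ge_atTop M] with N hN hMN
  -- The coefficient of s^k in (s+1)^N Q(1/(s+1)) = Σ_i (s+1)^{N-i} C_i. It is compared with
  -- C(N,k)·Q((N-k)/N).
  set E : ℕ → Matrix (Fin n) (Fin n) ℝ := fun k =>
    ∑ i ∈ Finset.range M, ((N - i).choose k : ℝ) • C i with hE
  have hEpsd : ∀ k ≤ N, (E k).PosSemidef := by
    intro k hk
    refine posSemidef_of_isSymm ?_ fun v => ?_
    · simp only [hE, IsSymm, transpose_sum, transpose_smul, (hCsymm _).eq]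
    have hN0 : (0 : ℝ) < N := by exact_mod_cast (show 0 < N by omega)
    have hkN : (k : ℝ) ≤ N := by exact_mod_cast hk
    set t := ((N : ℝ) - k) / N with ht
    have ht01 : t ∈ Set.Icc (0 : ℝ) 1 := ⟨div_nonneg (by linarith) hN0.le,
      (div_le_one hN0).2 (by linarith [(Nat.cast_nonneg k : (0 : ℝ) ≤ k)])⟩
    have h1 := hlow t ht01 v
    simp only [heval, sum_mulVec, dotProduct_sum, smul_mulVec, dotProduct_smul,
      smul_eq_mul] at h1
    simp only [hE, sum_mulVec, dotProduct_sum, smul_mulVec, dotProduct_smul, smul_eq_mul]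
    have hch : (0 : ℝ) ≤ N.choose k := Nat.cast_nonneg _
    have hvv : 0 ≤ v ⬝ᵥ v := Finset.sum_nonneg fun i _ => mul_self_nonneg _
    have h2 : ∀ i ∈ Finset.range M,
        N.choose k * (t ^ i * (v ⬝ᵥ (C i *ᵥ v))) - ε * N.choose k * (D i * (v ⬝ᵥ v)) ≤
          (N - i).choose k * (v ⬝ᵥ (C i *ᵥ v)) := by
      intro i hi
      have h3 := abs_le.1 (show |(((N - i).choose k : ℝ) - t ^ i * N.choose k) *
          (v ⬝ᵥ (C i *ᵥ v))| ≤ ε * N.choose k * (D i * (v ⬝ᵥ v)) by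
        rw [abs_mul]
        exact mul_le_mul (hN i hi k hk) (hD i v) (abs_nonneg _) (by positivity))
      linarith [h3.1]
    have h4 := Finset.sum_le_sum h2
    rw [Finset.sum_sub_distrib, ← Finset.mul_sum, ← Finset.mul_sum, ← Finset.sum_mul] at h4
    have h5 : ε * S ≤ c := by
      rw [hε, div_mul_eq_mul_div, div_le_iff₀ (by positivity)]
      nlinarith
    have h6 := mul_le_mul_of_nonneg_left h1 hch
    have h7 : ε * N.choose k * (S * (v ⬝ᵥ v)) ≤ N.choose k * (c * (v ⬝ᵥ v)) := by
      have := mul_le_mul_of_nonneg_left h5 (mul_nonneg hch hvv)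
      linarith
    linarith
  convert isSOS_sum_pow_smul hEpsd using 2 with ξ
  have hne : ξ ^ 2 + 1 ≠ 0 := by positivity
  simp only [hE, Finset.smul_sum, heval, smul_smul]
  rw [Finset.sum_comm]
  refine Finset.sum_congr rfl fun i hi => ?_
  have hi' : i ≤ N := by have := Finset.mem_range.1 hi; omega
  rw [← Finset.sum_smul]
  congr 1
  rw [inv_pow, ← pow_sub₀ _ hne hi', add_pow]
  refine Finset.sum_subset_zero_on_sdiff
    (Finset.range_mono (by omega)) (fun k hk => ?_) fun k _ => ?_
  · simp only [Finset.mem_sdiff, Finset.mem_range] at hk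
    rw [Nat.choose_eq_zero_of_lt (by omega)]
    simp
  · simp

end SumOfSquares

/-! ### Polynomial Lyapunov functions -/

section PolynomialLyapunov

variable {n m : ℕ}

/-- Positivity of the form of a symmetric matrix is an open condition. -/
theorem eventually_quadratic_pos {T : Type*} [TopologicalSpace T] {t₀ : T}
    {M : T → Matrix (Fin n) (Fin n) ℝ} (hM : ContinuousAt M t₀)
    (hpos : ∀ v : Fin n → ℝ, v ≠ 0 → 0 < v ⬝ᵥ (M t₀ *ᵥ v)) :
    ∀ᶠ t in 𝓝 t₀, ∀ v : Fin n → ℝ, v ≠ 0 → 0 < v ⬝ᵥ (M t *ᵥ v) := by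
  obtain ⟨c, hc, hlow⟩ := exists_lower_bound hpos
  have hsmall : ∀ᶠ t in 𝓝 t₀, ∀ i j, |(M t - M t₀) i j| ≤ c / (n + 1) := by
    refine eventually_all.2 fun i => eventually_all.2 fun j => ?_
    have h1 := (tendsto_pi_nhds.1 (tendsto_pi_nhds.1 hM.tendsto i) j).sub_const (M t₀ i j)
    rw [sub_self] at h1
    have h2 := h1.abs
    rw [abs_zero] at h2
    exact h2.eventually_le_const (by positivity)
  filter_upwards [hsmall] with t ht v hv
  have hvv : 0 < v ⬝ᵥ v := by
    have := dotProduct_star_self_pos_iff.2 hv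
    simpa using this
  have h2 := (abs_le.1 (abs_quadratic_le ht v)).1
  rw [sub_mulVec, dotProduct_sub] at h2
  have h3 : n * (c / ((n : ℝ) + 1)) < c := by
    rw [mul_div_assoc', div_lt_iff₀ (by positivity)]
    nlinarith
  nlinarith [hlow v]

variable (Ah : Matrix (Fin n) (Fin n) ℝ) (Bh : Matrix (Fin n) (Fin m) ℝ) (d : ℕ) (phat : ℝ)
  (K : Matrix (Fin m) (Fin n) ℝ)

theorem continuous_lyapunovL {T : Type*} [TopologicalSpace T] {f : T → ℝ}
    {X : T → Matrix (Fin n) (Fin n) ℝ} (hf : Continuous f) (hX : Continuous X) :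
    Continuous fun t => lyapunovL Ah Bh d K (f t) (X t) := by
  unfold lyapunovL
  fun_prop

theorem lyapunovL_add (p : ℝ) (X Y : Matrix (Fin n) (Fin n) ℝ) :
    lyapunovL Ah Bh d K p (X + Y) = lyapunovL Ah Bh d K p X + lyapunovL Ah Bh d K p Y := by
  simp only [lyapunovL_eq, map_add]
  abel

theorem lyapunovL_smul (p c : ℝ) (X : Matrix (Fin n) (Fin n) ℝ) :
    lyapunovL Ah Bh d K p (c • X) = c • lyapunovL Ah Bh d K p X := by
  simp only [lyapunovL_eq, map_smul, smul_sub]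

variable {phat}

/-- The solutions at a given t form a convex set, and a fixed solution remains one for nearby t
since strict positivity is open. A partition of unity glues these local constants. -/
theorem exists_continuous_lyapunov
    (h : ∀ t : unitInterval, ∃ X : Matrix (Fin n) (Fin n) ℝ, X.PosDef ∧
      (lyapunovL Ah Bh d K (phat * t) X).PosDef) :
    ∃ g : C(unitInterval, Matrix (Fin n) (Fin n) ℝ), ∀ t, (g t).PosDef ∧
      (lyapunovL Ah Bh d K (phat * t) (g t)).PosDef := by
  refine exists_continuous_forall_mem_convex_of_local_const
    (t := fun t : unitInterval => {X : Matrix (Fin n) (Fin n) ℝ | X.PosDef ∧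
      (lyapunovL Ah Bh d K (phat * t) X).PosDef}) (fun t => ?_) fun t => ?_
  · rw [convex_iff_forall_pos]
    rintro X ⟨hX1, hX2⟩ Y ⟨hY1, hY2⟩ a b ha hb -
    refine ⟨(hX1.smul ha).add (hY1.smul hb), ?_⟩
    rw [lyapunovL_add, lyapunovL_smul, lyapunovL_smul]
    exact (hX2.smul ha).add (hY2.smul hb)
  · obtain ⟨X, hX1, hX2⟩ := h t
    refine ⟨X, ?_⟩
    have hc : Continuous fun s : unitInterval => lyapunovL Ah Bh d K (phat * s) X :=
      continuous_lyapunovL Ah Bh d K (by fun_prop) continuous_const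
    filter_upwards [eventually_quadratic_pos hc.continuousAt hX2.quadratic_pos] with s hs
    exact ⟨hX1, posDef_of_isSymm
      (isSymm_lyapunovL _ _ _ _ _ (isSymm_of_isHermitian hX1.isHermitian)) hs⟩

theorem exists_polynomial_lyapunov
    (h : ∀ t : unitInterval, ∃ X : Matrix (Fin n) (Fin n) ℝ, X.PosDef ∧
      (lyapunovL Ah Bh d K (phat * t) X).PosDef) :
    ∃ P : Matrix (Fin n) (Fin n) ℝ[X], P.IsSymm ∧ ∀ t ∈ Set.Icc (0 : ℝ) 1, ∀ v : Fin n → ℝ,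
      v ≠ 0 → 0 < v ⬝ᵥ (evalMat P t *ᵥ v) ∧
        0 < v ⬝ᵥ (lyapunovL Ah Bh d K (phat * t) (evalMat P t) *ᵥ v) := by
  obtain ⟨g, hg⟩ := exists_continuous_lyapunov Ah Bh d K h
  -- By compactness of the interval, one size of perturbation is admissible for all t.
  have hev : ∀ᶠ E : Fin n → Fin n → ℝ in 𝓝 0, ∀ t ∈ (Set.univ : Set unitInterval),
      (∀ v : Fin n → ℝ, v ≠ 0 → 0 < v ⬝ᵥ ((g t + Matrix.of E) *ᵥ v)) ∧
      ∀ v : Fin n → ℝ, v ≠ 0 →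
        0 < v ⬝ᵥ (lyapunovL Ah Bh d K (phat * t) (g t + Matrix.of E) *ᵥ v) := by
    refine isCompact_univ.eventually_forall_of_forall_eventually fun t _ => ?_
    have hc1 : Continuous fun z : (Fin n → Fin n → ℝ) × unitInterval =>
        g z.2 + Matrix.of z.1 :=
      (g.continuous.comp continuous_snd).add continuous_fst
    have hc2 : Continuous fun z : (Fin n → Fin n → ℝ) × unitInterval =>
        lyapunovL Ah Bh d K (phat * z.2) (g z.2 + Matrix.of z.1) :=
      continuous_lyapunovL Ah Bh d K (by fun_prop) hc1
    have h0 : g t + Matrix.of (0 : Fin n → Fin n → ℝ) = g t := add_zero (g t)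
    refine (eventually_quadratic_pos hc1.continuousAt ?_).and
      (eventually_quadratic_pos hc2.continuousAt ?_)
    · simp only [h0]
      exact (hg t).1.quadratic_pos
    · simp only [h0]
      exact (hg t).2.quadratic_pos
  obtain ⟨ε, hε, hball⟩ := Metric.eventually_nhds_iff.1 hev
  have happrox : ∀ i j, ∃ q : ℝ[X], ∀ t : unitInterval, |q.eval (t : ℝ) - g t i j| < ε := by
    intro i j
    obtain ⟨q, hq⟩ := exists_polynomial_near_continuousMap 0 1
      ⟨fun t => g t i j, (g.continuous.matrix_elem i j)⟩ ε hε
    exact ⟨q, (ContinuousMap.norm_lt_iff _ hε).1 hq⟩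
  choose q hq using happrox
  have hevalP : ∀ t i j, evalMat (Matrix.of fun i j => Polynomial.C (1 / 2) * (q i j + q j i)) t
      i j = 1 / 2 * ((q i j).eval t + (q j i).eval t) := fun t i j => by
    simp [evalMat_apply]
  -- Symmetrizing the entrywise approximations keeps the error below ε, because `g t` is symmetric.
  refine ⟨Matrix.of fun i j => Polynomial.C (1 / 2) * (q i j + q j i), ?_, fun t ht => ?_⟩
  · ext1 i j
    simp [add_comm]
  set P := Matrix.of fun i j => Polynomial.C (1 / 2 : ℝ) * (q i j + q j i)
  have hE := hball (y := fun i j => (evalMat P t - g ⟨t, ht⟩) i j) ?_ ⟨t, ht⟩ trivial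
  · have e : g ⟨t, ht⟩ + Matrix.of (fun i j => (evalMat P t - g ⟨t, ht⟩) i j) = evalMat P t :=
      add_sub_cancel _ _
    rw [e] at hE
    exact fun v hv => ⟨hE.1 v hv, hE.2 v hv⟩
  · refine (dist_pi_lt_iff hε).2 fun i => (dist_pi_lt_iff hε).2 fun j => ?_
    have hs := (isSymm_of_isHermitian (hg ⟨t, ht⟩).1.isHermitian).apply i j
    have h1 := abs_lt.1 (hq i j ⟨t, ht⟩)
    have h2 := abs_lt.1 (hq j i ⟨t, ht⟩)
    rw [hs] at h2
    rw [Real.dist_eq, Matrix.sub_apply, hevalP]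
    simp only [Pi.zero_apply, sub_zero]
    rw [abs_lt]
    constructor <;> linarith [h1.1, h1.2, h2.1, h2.2]

theorem evalMat_eq_mapMatrix (P : Matrix (Fin n) (Fin n) ℝ[X]) (t : ℝ) :
    evalMat P t = (Polynomial.evalRingHom t).mapMatrix P := rfl

theorem evalMat_map_C (X : Matrix (Fin n) (Fin n) ℝ) (t : ℝ) :
    evalMat (X.map Polynomial.C) t = X := by
  ext i j
  simp [evalMat_apply]

theorem evalMat_transpose (P : Matrix (Fin n) (Fin n) ℝ[X]) (t : ℝ) :
    evalMat Pᵀ t = (evalMat P t)ᵀ := rfl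

theorem evalMat_mul (P Q : Matrix (Fin n) (Fin n) ℝ[X]) (t : ℝ) :
    evalMat (P * Q) t = evalMat P t * evalMat Q t := by
  simp only [evalMat_eq_mapMatrix, map_mul]

theorem evalMat_add (P Q : Matrix (Fin n) (Fin n) ℝ[X]) (t : ℝ) :
    evalMat (P + Q) t = evalMat P t + evalMat Q t := by
  simp only [evalMat_eq_mapMatrix, map_add]

theorem evalMat_sub (P Q : Matrix (Fin n) (Fin n) ℝ[X]) (t : ℝ) :
    evalMat (P - Q) t = evalMat P t - evalMat Q t := by
  simp only [evalMat_eq_mapMatrix, map_sub]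

theorem evalMat_smul (q : ℝ[X]) (P : Matrix (Fin n) (Fin n) ℝ[X]) (t : ℝ) :
    evalMat (q • P) t = q.eval t • evalMat P t := by
  ext i j
  simp [evalMat_apply]

/-- The Lyapunov operator at the rate `phat * t` maps matrix polynomials in `t` to matrix
polynomials in `t`. -/
theorem exists_evalMat_eq_lyapunovL (phat : ℝ) {P : Matrix (Fin n) (Fin n) ℝ[X]} (hP : P.IsSymm) :
    ∃ R : Matrix (Fin n) (Fin n) ℝ[X], R.IsSymm ∧
      ∀ t, evalMat R t = lyapunovL Ah Bh d K (phat * t) (evalMat P t) := by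
  set r : ℝ[X] := Polynomial.C phat * Polynomial.X with hr
  have hrt : ∀ t, r.eval t = phat * t := fun t => by simp [hr]
  set F := Ah.map Polynomial.C + (1 - r) • (Bh * K).map Polynomial.C with hF
  set G := (Ah ^ d * (Bh * K)).map (Polynomial.C : ℝ →+* ℝ[X]) with hG
  refine ⟨P - Fᵀ * P * F - (r * (1 - r)) • (Gᵀ * P * G), ?_, fun t => ?_⟩
  · simp only [IsSymm, transpose_sub, transpose_smul, transpose_mul, transpose_transpose, hP.eq,
      Matrix.mul_assoc]
  · simp only [evalMat_sub, evalMat_mul, evalMat_smul, evalMat_transpose, lyapunovL_eq,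
      congruence_apply, LinearMap.smul_apply, hF, hG, evalMat_add, evalMat_map_C,
      Polynomial.eval_mul, Polynomial.eval_sub, Polynomial.eval_one, hrt]

theorem exists_homogenization {P : Matrix (Fin n) (Fin n) ℝ[X]} {N : ℕ} (hN : matDegree P ≤ N) :
    ∃ Q : Matrix (Fin n) (Fin n) ℝ[X], matDegree Q ≤ N ∧
      ∀ s : ℝ, s + 1 ≠ 0 → evalMat Q s = (s + 1) ^ N • evalMat P (s + 1)⁻¹ := by
  refine ⟨Matrix.of fun a b => ∑ i ∈ Finset.range (N + 1),
    Polynomial.C ((P a b).coeff i) * (Polynomial.X + Polynomial.C 1) ^ (N - i), ?_,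
    fun s hs => ?_⟩
  · rw [matDegree_le_iff]
    intro a b
    rw [of_apply]
    refine Polynomial.natDegree_sum_le_of_forall_le _ _ fun i _ => ?_
    refine (Polynomial.natDegree_C_mul_le _ _).trans (Polynomial.natDegree_pow_le.trans ?_)
    rw [Polynomial.natDegree_X_add_C, mul_one]
    exact Nat.sub_le N i
  · rw [evalMat_eq_sum (Nat.lt_succ_of_le hN)]
    ext a b
    rw [evalMat_apply, of_apply, Polynomial.eval_finsetSum, Matrix.smul_apply,
      Matrix.sum_apply, Finset.smul_sum]
    refine Finset.sum_congr rfl fun i hi => ?_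
    have hi' : i ≤ N := by have := Finset.mem_range.1 hi; omega
    simp only [Polynomial.eval_mul, Polynomial.eval_C, Polynomial.eval_pow, Polynomial.eval_add,
      Polynomial.eval_X, Matrix.smul_apply, Matrix.map_apply, smul_eq_mul]
    rw [pow_sub₀ _ hs hi', inv_pow]
    ring

theorem sosCondition_of_forall_lyapunov
    (h : ∀ t : unitInterval, ∃ X : Matrix (Fin n) (Fin n) ℝ, X.PosDef ∧
      (lyapunovL Ah Bh d K (phat * t) X).PosDef) : SOSCondition Ah Bh d phat K := by
  obtain ⟨P, hP, hpos⟩ := exists_polynomial_lyapunov Ah Bh d K h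
  obtain ⟨R, hR, hRL⟩ := exists_evalMat_eq_lyapunovL Ah Bh d K phat hP
  have hcont : ∀ Q : Matrix (Fin n) (Fin n) ℝ[X],
      ContinuousOn (fun t => evalMat Q t) (Set.Icc 0 1) := fun Q =>
    continuousOn_pi.2 fun a => continuousOn_pi.2 fun b => (Q a b).continuous.continuousOn
  obtain ⟨c₁, hc₁, h₁⟩ := exists_uniform_lower_bound isCompact_Icc (hcont P)
    fun t ht v hv => (hpos t ht v hv).1
  obtain ⟨c₂, hc₂, h₂⟩ := exists_uniform_lower_bound isCompact_Icc (hcont R)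
    fun t ht v hv => by rw [hRL]; exact (hpos t ht v hv).2
  -- Strictly below both margins, so that P - θI and R - θI remain positive definite on [0,1].
  set θ := min c₁ c₂ / 2 with hθ
  have hθ0 : 0 < θ := half_pos (lt_min hc₁ hc₂)
  have hθ₁ : θ < c₁ := (half_lt_self (lt_min hc₁ hc₂)).trans_le (min_le_left _ _)
  have hθ₂ : θ < c₂ := (half_lt_self (lt_min hc₁ hc₂)).trans_le (min_le_right _ _)
  have hshift : ∀ (Q : Matrix (Fin n) (Fin n) ℝ[X]) (t : ℝ),
      evalMat (Q - (θ • (1 : Matrix (Fin n) (Fin n) ℝ)).map Polynomial.C) t =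
        evalMat Q t - θ • (1 : Matrix (Fin n) (Fin n) ℝ) := fun Q t => by
    rw [evalMat_sub, evalMat_map_C]
  have hsos : ∀ (Q : Matrix (Fin n) (Fin n) ℝ[X]) (c : ℝ), Q.IsSymm → θ < c →
      (∀ t ∈ Set.Icc (0 : ℝ) 1, ∀ v : Fin n → ℝ, c * (v ⬝ᵥ v) ≤ v ⬝ᵥ (evalMat Q t *ᵥ v)) →
      ∀ᶠ N : ℕ in atTop, IsSOS fun ξ => (ξ ^ 2 + 1) ^ N •
        (evalMat Q (ξ ^ 2 + 1)⁻¹ - θ • (1 : Matrix (Fin n) (Fin n) ℝ)) := by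
    intro Q c hQ hθc hQc
    simp only [← hshift]
    refine eventually_isSOS_of_pos ?_ fun t ht v hv => ?_
    · rw [IsSymm, transpose_sub, hQ.eq, ← transpose_map, transpose_smul, transpose_one]
    · have hvv : 0 < v ⬝ᵥ v := by
        have := dotProduct_star_self_pos_iff.2 hv
        simpa using this
      rw [hshift, sub_mulVec, dotProduct_sub, smul_mulVec, one_mulVec, dotProduct_smul,
        smul_eq_mul]
      nlinarith [hQc t ht v]
  -- The degree is N for P but N + 1 for R: the second SOS condition carries an additional factor ξ²
  -- + 1.
  obtain ⟨N, ⟨hN1, hN2⟩, hN3⟩ := (((hsos P c₁ hP hθ₁ h₁).and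
    ((tendsto_add_atTop_nat 1).eventually (hsos R c₂ hR hθ₂ h₂))).and
      (eventually_ge_atTop (matDegree P))).exists
  obtain ⟨Pt, hPtdeg, hPt⟩ := exists_homogenization hN3
  have hPteval : ∀ ξ : ℝ, evalMat Pt (ξ ^ 2) = (ξ ^ 2 + 1) ^ N • evalMat P (ξ ^ 2 + 1)⁻¹ :=
    fun ξ => hPt _ (by positivity)
  refine ⟨Pt, θ, N, hθ0, hPtdeg, ?_, ?_⟩
  · convert hN1 using 2 with ξ
    rw [hPteval, smul_sub, smul_smul]
  · convert hN2 using 2 with ξ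
    have hne : ξ ^ 2 + 1 ≠ 0 := by positivity
    simp only [lyapunovH]
    rw [hPteval, lyapunovL_smul, hRL, smul_sub, smul_smul, smul_smul, ← pow_succ',
      div_eq_mul_inv]

end PolynomialLyapunov

/-! ### From sums of squares to stability -/

section Converse

variable {n m : ℕ}

theorem IsSOS.posSemidef {F : ℝ → Matrix (Fin n) (Fin n) ℝ} (hF : IsSOS F) (ξ : ℝ) :
    (F ξ).PosSemidef := by
  obtain ⟨r, M, hM⟩ := hF
  rw [hM]
  refine posSemidef_sum _ fun i _ => ?_
  have := posSemidef_conjTranspose_mul_self (evalMat (M i) ξ)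
  rwa [conjTranspose_eq_transpose_of_trivial] at this

variable {Ah : Matrix (Fin n) (Fin n) ℝ} {Bh : Matrix (Fin n) (Fin m) ℝ} {d : ℕ} {phat : ℝ}
  {K : Matrix (Fin m) (Fin n) ℝ}

theorem exists_lyapunov_of_sosCondition (h : SOSCondition Ah Bh d phat K) :
    ∀ t ∈ Set.Icc (0 : ℝ) 1, ∃ X : Matrix (Fin n) (Fin n) ℝ, X.PosSemidef ∧
      ∀ v : Fin n → ℝ, v ≠ 0 → 0 < v ⬝ᵥ (lyapunovL Ah Bh d K (phat * t) X *ᵥ v) := by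
  obtain ⟨P, θ, ζ, hθ, hdeg, hS1, hS2⟩ := h
  -- H(t) = t^ζ P((1-t)/t) for t in (0,1]; since deg P ≤ ζ it is polynomial in t, hence defined and
  -- continuous at t = 0, which corresponds to ξ = ∞ and rate 0.
  set H : ℝ → Matrix (Fin n) (Fin n) ℝ := fun t => ∑ i ∈ Finset.range (ζ + 1),
    ((1 - t) ^ i * t ^ (ζ - i)) • P.map (fun q => q.coeff i) with hH
  have hHc : Continuous H := by
    rw [hH]
    fun_prop
  have hHpos : ∀ t ∈ Set.Ioc (0 : ℝ) 1, ∃ ξ : ℝ, ξ ^ 2 + 1 = t⁻¹ ∧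
      H t = t ^ ζ • evalMat P (ξ ^ 2) := by
    intro t ht
    have ht1 : 0 ≤ t⁻¹ - 1 := by
      rw [sub_nonneg]
      exact (one_le_inv₀ ht.1).2 ht.2
    refine ⟨√(t⁻¹ - 1), by rw [Real.sq_sqrt ht1]; ring, ?_⟩
    rw [Real.sq_sqrt ht1, evalMat_eq_sum (Nat.lt_succ_of_le hdeg), hH, Finset.smul_sum]
    refine Finset.sum_congr rfl fun i hi => ?_
    have hi' : i ≤ ζ := by have := Finset.mem_range.1 hi; omega
    have hne : t ≠ 0 := ht.1.ne'
    rw [smul_smul]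
    congr 1
    rw [show t⁻¹ - 1 = (1 - t) * t⁻¹ by field_simp, mul_pow, pow_sub₀ _ hne hi', inv_pow]
    ring
  have hclosed : IsClosed {t : ℝ | (H t).IsSymm ∧
      ∀ v : Fin n → ℝ, θ * (v ⬝ᵥ v) ≤ v ⬝ᵥ (H t *ᵥ v) ∧
        θ * (v ⬝ᵥ v) ≤ v ⬝ᵥ (lyapunovL Ah Bh d K (phat * t) (H t) *ᵥ v)} := by
    have hquad : ∀ {M : ℝ → Matrix (Fin n) (Fin n) ℝ}, Continuous M → ∀ v : Fin n → ℝ,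
        Continuous fun t => v ⬝ᵥ (M t *ᵥ v) := fun hM v =>
      continuous_const.dotProduct (hM.matrix_mulVec continuous_const)
    have hL : Continuous fun t => lyapunovL Ah Bh d K (phat * t) (H t) :=
      continuous_lyapunovL Ah Bh d K (by fun_prop) hHc
    simp only [Set.ofPred_and, Set.ofPred_forall]
    exact (isClosed_eq hHc.matrix_transpose hHc).inter (isClosed_iInter fun v =>
      (isClosed_le continuous_const (hquad hHc v)).inter
        (isClosed_le continuous_const (hquad hL v)))
  have hsub : Set.Ioc (0 : ℝ) 1 ⊆ {t : ℝ | (H t).IsSymm ∧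
      ∀ v : Fin n → ℝ, θ * (v ⬝ᵥ v) ≤ v ⬝ᵥ (H t *ᵥ v) ∧
        θ * (v ⬝ᵥ v) ≤ v ⬝ᵥ (lyapunovL Ah Bh d K (phat * t) (H t) *ᵥ v)} := by
    intro t ht
    obtain ⟨ξ, hξ, hHξ⟩ := hHpos t ht
    have hne : t ≠ 0 := ht.1.ne'
    have hs1 := hS1.posSemidef ξ
    have hs2 := hS2.posSemidef ξ
    refine ⟨?_, fun v => ⟨?_, ?_⟩⟩
    -- Symmetry of the values of P is not assumed; it comes from the first SOS condition.
    · have := isSymm_of_isHermitian hs1.isHermitian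
      rw [IsSymm, transpose_sub, transpose_smul, transpose_one, sub_left_inj] at this
      rw [hHξ, IsSymm, transpose_smul, this]
    · have h1 := hs1.quadratic_nonneg v
      rw [hξ, sub_mulVec, dotProduct_sub, smul_mulVec, one_mulVec, dotProduct_smul,
        smul_eq_mul] at h1
      rw [hHξ, smul_mulVec, dotProduct_smul, smul_eq_mul]
      have h2 := mul_nonneg (pow_nonneg ht.1.le ζ) h1
      have h3 : t ^ ζ * (t⁻¹ ^ ζ * θ * (v ⬝ᵥ v)) = θ * (v ⬝ᵥ v) := by
        rw [inv_pow]; field_simp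
      linarith
    · have h1 := hs2.quadratic_nonneg v
      simp only [lyapunovH] at h1
      rw [hξ, sub_mulVec, dotProduct_sub, smul_mulVec, smul_mulVec, one_mulVec, dotProduct_smul,
        dotProduct_smul, smul_eq_mul, smul_eq_mul, div_inv_eq_mul] at h1
      rw [hHξ, lyapunovL_smul, smul_mulVec, dotProduct_smul, smul_eq_mul]
      have h2 := mul_nonneg (pow_nonneg ht.1.le (ζ + 1)) h1
      have h3 : t ^ (ζ + 1) * (t⁻¹ ^ (ζ + 1) * θ * (v ⬝ᵥ v)) = θ * (v ⬝ᵥ v) := by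
        rw [inv_pow]; field_simp
      have h4 : ∀ y : ℝ, t ^ (ζ + 1) * (t⁻¹ * y) = t ^ ζ * y := fun y => by
        rw [pow_succ]; field_simp
      rw [mul_sub, h3, h4] at h2
      linarith
  intro t ht
  -- The inequalities with margin θ are closed conditions, so they extend from (0,1] to t = 0.
  have hmem := closure_minimal hsub hclosed (by rwa [closure_Ioc zero_ne_one] : t ∈ _)
  refine ⟨H t, posSemidef_of_isSymm hmem.1 fun v => ?_, fun v hv => ?_⟩
  · exact (mul_nonneg hθ.le (Finset.sum_nonneg fun i _ => mul_self_nonneg _)).trans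
      (hmem.2 v).1
  · have hvv : 0 < v ⬝ᵥ v := by
      have := dotProduct_star_self_pos_iff.2 hv
      simpa using this
    exact (mul_pos hθ hvv).trans_le (hmem.2 v).2

end Converse

/-- The sum-of-squares test is exact for every gain. -/
theorem isRobustlyStabilizedBy_iff_sosCondition {n m : ℕ} {Ah : Matrix (Fin n) (Fin n) ℝ}
    (hA : IsUnit Ah) (Bh : Matrix (Fin n) (Fin m) ℝ) (d : ℕ)
    {Ω : unitInterval → Type*} [∀ p, MeasurableSpace (Ω p)]
    (μ : ∀ p, Measure (Ω p)) [∀ p, IsProbabilityMeasure (μ p)]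
    (γ : ∀ p, ℕ → Ω p → ℝ)
    (hγ : ∀ p : unitInterval, IsDropoutProcess (p : ℝ) (μ p) (γ p))
    {phat : ℝ} (hphat : 0 ≤ phat) (hphat1 : phat ≤ 1) (K : Matrix (Fin m) (Fin n) ℝ) :
    IsRobustlyStabilizedBy μ γ Ah Bh d phat K ↔ SOSCondition Ah Bh d phat K := by
  constructor
  · intro h
    refine sosCondition_of_forall_lyapunov Ah Bh d K fun t => ?_
    have h0 : 0 ≤ phat * t := mul_nonneg hphat t.2.1
    have h1 : phat * t ≤ phat := mul_le_of_le_one_right hphat t.2.2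
    exact exists_lyapunov_of_isStabilizedBy (hγ ⟨phat * t, h0, h1.trans hphat1⟩) h0
      (h1.trans hphat1) hA (h _ h1)
  · intro h p hp
    obtain ⟨t, ht, htp⟩ : ∃ t ∈ Set.Icc (0 : ℝ) 1, phat * t = p := by
      rcases hphat.eq_or_lt with h0 | h0
      -- If phat = 0, the only rate is 0 and any t represents it.
      · exact ⟨1, by simp, by rw [← h0] at hp ⊢; linarith [p.2.1]⟩
      · exact ⟨p / phat, ⟨div_nonneg p.2.1 hphat, (div_le_one h0).2 hp⟩, by field_simp⟩
    obtain ⟨X, hX, hL⟩ := exists_lyapunov_of_sosCondition h t ht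
    rw [htp] at hL
    exact isStabilizedBy_of_lyapunov (hγ p) p.2.1 p.2.2 hX hL

theorem theorem1 {n m : ℕ} (A : Matrix (Fin n) (Fin n) ℝ) (B : Matrix (Fin n) (Fin m) ℝ)
    (h : ℝ) (hh : 0 < h) (d : ℕ) (hd : 1 ≤ d)
    (H1_distinct : HasDistinctRealEigenvalues A) (H1_unstable : IsUnstable A)
    (H2 : B.rank = m) (H3 : IsControllable A B)
    {Ω : unitInterval → Type*} [∀ p, MeasurableSpace (Ω p)]
    (μ : ∀ p, Measure (Ω p)) [∀ p, IsProbabilityMeasure (μ p)]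
    (γ : ∀ p, ℕ → Ω p → ℝ)
    (hγ : ∀ p : unitInterval, IsDropoutProcess (p : ℝ) (μ p) (γ p))
    (phat : ℝ) (hphat : 0 ≤ phat)
    (hmax : phat < maxDropoutRate μ γ (sampledA A h) (sampledB A B h) d) :
    ((∃ K : Matrix (Fin m) (Fin n) ℝ,
        IsRobustlyStabilizedBy μ γ (sampledA A h) (sampledB A B h) d phat K) ↔
      ∃ K : Matrix (Fin m) (Fin n) ℝ,
        SOSCondition (sampledA A h) (sampledB A B h) d phat K) ∧
    ∀ K : Matrix (Fin m) (Fin n) ℝ,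
      IsRobustlyStabilizedBy μ γ (sampledA A h) (sampledB A B h) d phat K ↔
        SOSCondition (sampledA A h) (sampledB A B h) d phat K := by
  have hphat1 : phat ≤ 1 :=
    hmax.le.trans (Real.sSup_le (fun q hq => hq.2.1) zero_le_one)
  have key := isRobustlyStabilizedBy_iff_sosCondition (Matrix.isUnit_exp (h • A))
    (sampledB A B h) d μ γ hγ hphat hphat1
  exact ⟨exists_congr key, key⟩
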